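/- \textbf{Setting.} Fix a compressed monoidal signature $T=(O,M,\mathrm{dom},\mathrm{cod})$ (each $f\in M$ has lists $\mathrm{dom}(f),\mathrm{cod}(f)$ of objects in $O$, each entry marked as of fixed or of variable arity) and a set $\mathcal A$ of tags. All graphs are finite and directed, and typed: vertices are wire-vertices (type in $O$), node-vertices (type in $M$) or $!$-vertices; edges are of type $X\to X$ ($X\in O$), $\mathrm{dom}(f)[i]\to f$, $f\to\mathrm{cod}(f)[i]$, or go from a $!$-vertex to any vertex. Discarding the $!$-vertices gives $U(G)$. $U(G)$ is a \emph{string graph} if each wire-vertex has at most one in-edge and at most one out-edge in $U(G)$, and each node-vertex of type $f$ has exactly one incident edge for each fixed-arity entry of $\mathrm{dom}(f)$ and $\mathrm{cod}(f)$. A wire-vertex is an input (output) if it has no in-edge (out-edge) in $U(G)$; the boundary consists of the inputs and outputs. $B(b)$ is the full subgraph on the successors of the $!$-vertex $b$. $G$ is a \emph{$!$-graph} if $U(G)$ is a string graph, the $!$-vertices with the edges between them form a partial order (at most one edge from one to another), every $U(B(b))$ is open in $U(G)$ (not adjacent to a wire-vertex outside it, not incident to a fixed-arity edge), and $B(c)\subseteq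 B(b)$ for each $!$-vertex $c\in B(b)$. Some $!$-vertices may carry a tag from $\mathcal A$; they are called \emph{fixed} ($x$-fixed if the tag is $x$). A $!$-vertex is \emph{top-level} if it has no predecessor but itself. A graph without $!$-vertices is \emph{concrete}. A \emph{$!$-graph equation} $G\approx H$ is a span of monomorphisms $G\xleftarrow{i}I\xrightarrow{j}H$ of $!$-graphs which preserve and reflect tags, where $U(G)$ and $U(H)$ have no isolated wire-vertices, the images of $i$ and $j$ are exactly the subgraphs formed by the $!$-vertices, the boundary vertices, and the edges from $!$-vertices to these, and $i(v)$ is an input (output) iff $j(v)$ is. So $G,I,H$ share their $!$-vertices. All fixed $!$-vertices are required to be top-level. A \emph{string graph equation} is a concrete $!$-graph equation. For a $!$-vertex $b$: $\mathrm{KILL}_b(G)=G\setminus B(b)$; $\mathrm{DROP}_b(G)=G\setminus b$; $\mathrm{COPY}_b(G)$ is the pushout of the inclusion $G\setminus B(b)\hookrightarrow G$ with itself, with copies $b^0,b^1$ of $b$; $\mathrm{EXP}_b$ is $\mathrm{COPY}_b$ followed by $\mathrm{DROP}_{b^1}$, with $b^0$ again called $b$; $\mathrm{FIX}^x_b(G)$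 is $G$ with $b$ made $x$-fixed. These are applied to an equation by applying them to the whole span. An \emph{instance} of an equation is obtained, up to isomorphism, by applying finitely many $\mathrm{COPY}$, $\mathrm{DROP}$ and $\mathrm{KILL}$ operations. For a set $S$ of string graph equations, $S\vdash G\approx H$ denotes derivability in the equational logic of string graphs, whose rules are: axioms from $S$; reflexivity, symmetry and transitivity (composing spans along their common boundary); the Leibniz rule (from $G\leftarrow I\to H$ infer $G'\leftarrow I'\to H'$, a string graph equation, whenever there are a string graph $D$ and monomorphisms $I\to D$, $I'\to D$ such that $G'$ and $H'$ are the pushouts, i.e. unions, of $D$ with $G$ and with $H$ over $I$, and the legs $I'\to G'$, $I'\to H'$ factor through $D$); and replacing both sides by wire-homeomorphic string graphs, compatibly on the boundary, to give another string graph equation. (Two string graphs are wire-homeomorphic if there are type-preserving bijections between their node-vertices, boundary vertices and wires which respect sources and targets of wires and the types of the edges attaching wires to node-vertices; a wire is a maximal chain of edges consecutive at wire-vertices.) \textbf{Semantics.} Let $E$ be a set of $!$-graph equations, and let $A$ be the set of tags occurring in $G\approx H$. For $\lambda:A\to\mathbb N_0$ and an equation $L\approx R$ whose tags lie in $A$,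 let $X_\lambda(L\approx R)$ be the result of applying, for each $x\in A$ and each $x$-fixed $!$-vertex $b$ of it, $\lambda(x)$ operations $\mathrm{EXP}_b$ and then $\mathrm{KILL}_b$ (the order of the vertices does not matter up to isomorphism). Let $E_\lambda$ be the set of all $X_\lambda(L\approx R)$ with $L\approx R$ in $E$ having no fixed $!$-vertex with tag outside $A$, and let $\widetilde{E_\lambda}$ be the set of concrete instances of equations in $E_\lambda$. We write $E\models G\approx H$ ("$E$ proves $G\approx H$") if for every $\lambda:A\to\mathbb N_0$ and every concrete instance $G'\approx H'$ of $X_\lambda(G\approx H)$ we have $\widetilde{E_\lambda}\vdash G'\approx H'$. \textbf{Theorem} (\textsc{Induct} is sound). Let $E$ be a set of $!$-graph equations, $G\approx H$ a $!$-graph equation, $b$ a top-level $!$-vertex of it that is not fixed, and $x\in\mathcal A$ a tag that occurs neither in $G\approx H$ nor in any equation of $E$. If \[ E\models \mathrm{KILL}_b(G\approx H)\quad\text{and}\quad E\cup\{\mathrm{FIX}^x_b(G\approx H)\}\models \mathrm{FIX}^x_b(\mathrm{EXP}_b(G\approx H)),\] then $E\models G\approx H$. -/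

import Mathlib

set_option linter.checkUnivs false

universe u v w

namespace BangGraph

/-- Whether an input or output of a node type has fixed (single) or variable arity. -/
inductive Arity
  | fixed
  | variadic

/-- A compressed monoidal signature `(O, M, dom, cod)`. -/
structure Signature where
  O : Type u
  M : Type v
  dom : M → List (O × Arity)
  cod : M → List (O × Arity)

/-- Vertices of the derived compressed `!`-typegraph: `O + M` and the extra vertex `!`. -/
inductive VTy (T : Signature.{u, v})
  | wire (X : T.O)
  | node (f : T.M)
  | bang

/-- Edges of the derived compressed `!`-typegraph: `mid X : X → X`, `inp f i : dom(f)[i] → f`,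
`out f i : f → cod(f)[i]`, and an edge `box t` from `!` to every vertex `t` (also to `!`). -/
inductive ETy (T : Signature.{u, v})
  | mid (X : T.O)
  | inp (f : T.M) (i : Fin (T.dom f).length)
  | out (f : T.M) (i : Fin (T.cod f).length)
  | box (t : VTy T)

namespace ETy

variable {T : Signature.{u, v}}

def src : ETy T → VTy T
  | mid X => .wire X
  | inp f i => .wire ((T.dom f).get i).1
  | out f _ => .node f
  | box _ => .bang

def tgt : ETy T → VTy T
  | mid X => .wire X
  | inp f _ => .node f
  | out f i => .wire ((T.cod f).get i).1
  | box t => t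

/-- Fixed-arity edge types. -/
def IsFixed : ETy T → Prop
  | mid _ => False
  | inp f i => ((T.dom f).get i).2 = .fixed
  | out f i => ((T.cod f).get i).2 = .fixed
  | box _ => False

/-- The object carried by an edge between wire- and node-vertices. -/
def obj : ETy T → Option T.O
  | mid X => some X
  | inp f i => some ((T.dom f).get i).1
  | out f i => some ((T.cod f).get i).1
  | box _ => none

end ETy

/-- A finite graph typed over the derived compressed `!`-typegraph of `T`, with a partial map
`tag` from its `!`-vertices to the set of fixing tags. -/
structure Graph (T : Signature.{u, v}) (Tag : Type w) where
  V : Type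
  E : Type
  finV : Finite V
  finE : Finite E
  src : E → V
  tgt : E → V
  vty : V → VTy T
  ety : E → ETy T
  src_ty : ∀ e, vty (src e) = (ety e).src
  tgt_ty : ∀ e, vty (tgt e) = (ety e).tgt
  tag : V → Option Tag
  tag_bang : ∀ x, tag x ≠ none → vty x = .bang

variable {T : Signature.{u, v}} {Tag : Type w}

namespace Graph

variable (G : Graph T Tag)

def IsBang (x : G.V) : Prop := G.vty x = .bang

def IsWire (x : G.V) : Prop := ∃ X, G.vty x = .wire X

def IsNode (x : G.V) : Prop := ∃ f, G.vty x = .node f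

/-- The set of `!`-vertices. -/
abbrev Bang : Type := {x : G.V // G.IsBang x}

/-- The edges of `U(G)`, i.e. those whose source (hence also target) is not a `!`-vertex. -/
def IsPlain (e : G.E) : Prop := ¬ G.IsBang (G.src e)

/-- A wire-vertex whose only in-edges are from `!`-vertices. -/
def IsInput (x : G.V) : Prop := G.IsWire x ∧ ∀ e, G.IsPlain e → G.tgt e ≠ x

def IsOutput (x : G.V) : Prop := G.IsWire x ∧ ∀ e, G.IsPlain e → G.src e ≠ x

def IsBoundary (x : G.V) : Prop := G.IsInput x ∨ G.IsOutput x

/-- `G` has no `!`-vertices. -/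
def Concrete : Prop := ∀ x, ¬ G.IsBang x

/-- `U(G)` has no isolated wire-vertices. -/
def NoIsolatedWires : Prop := ∀ x, ¬ (G.IsInput x ∧ G.IsOutput x)

/-- The vertices of the `!`-box `B(b)`: the successors of `b`. In a `!`-graph `b` is a successor
of itself; putting `b` in by definition makes no difference there. -/
def box (b : G.V) : Set G.V := {x | x = b ∨ ∃ e, G.src e = b ∧ G.tgt e = x}

/-- `b` has no predecessor other than itself. -/
def TopLevel (b : G.V) : Prop := ∀ e, G.tgt e = b → G.src e = b

/-- `U(G)` is a string graph: the typing is arity-matching, and each wire-vertex has at most one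
incoming and at most one outgoing edge. -/
structure IsString : Prop where
  arity_in : ∀ x f, G.vty x = .node f → ∀ i, (ETy.inp f i : ETy T).IsFixed →
    ∃! e, G.tgt e = x ∧ G.ety e = .inp f i
  arity_out : ∀ x f, G.vty x = .node f → ∀ i, (ETy.out f i : ETy T).IsFixed →
    ∃! e, G.src e = x ∧ G.ety e = .out f i
  wire_in : ∀ e e', G.IsPlain e → G.IsPlain e' → G.IsWire (G.tgt e) →
    G.tgt e = G.tgt e' → e = e'
  wire_out : ∀ e e', G.IsPlain e → G.IsPlain e' → G.IsWire (G.src e) →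
    G.src e = G.src e' → e = e'

/-- The full subgraph of `U(G)` on the non-`!` vertices in `S` is an open subgraph of `U(G)`: it is
not adjacent to any wire-vertex and not incident to any fixed-arity edge. -/
def IsOpen (S : Set G.V) : Prop :=
  ∀ e, G.IsPlain e →
    (G.src e ∈ S → G.tgt e ∉ S → ¬ G.IsWire (G.tgt e) ∧ ¬ (G.ety e).IsFixed) ∧
    (G.tgt e ∈ S → G.src e ∉ S → ¬ G.IsWire (G.src e) ∧ ¬ (G.ety e).IsFixed)

/-- `G` is a `!`-graph. -/
structure IsBangGraph : Prop where
  string : G.IsString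
  simple : ∀ e e', G.IsBang (G.src e) → G.IsBang (G.tgt e) →
    G.src e = G.src e' → G.tgt e = G.tgt e' → e = e'
  refl : ∀ b, G.IsBang b → ∃ e, G.src e = b ∧ G.tgt e = b
  antisymm : ∀ e e', G.IsBang (G.src e) → G.IsBang (G.tgt e) →
    G.src e = G.tgt e' → G.tgt e = G.src e' → G.src e = G.tgt e
  trans : ∀ e e', G.IsBang (G.src e) → G.IsBang (G.tgt e) → G.IsBang (G.tgt e') →
    G.tgt e = G.src e' → ∃ e'', G.src e'' = G.src e ∧ G.tgt e'' = G.tgt e'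
  isOpen : ∀ b, G.IsBang b → G.IsOpen (G.box b)
  nesting : ∀ b b', G.IsBang b → G.IsBang b' → b' ∈ G.box b → G.box b' ⊆ G.box b

/-- `G` without the vertices in `S` and the edges incident to them. -/
def del (S : Set G.V) : Graph T Tag where
  V := {x : G.V // x ∉ S}
  E := {e : G.E // G.src e ∉ S ∧ G.tgt e ∉ S}
  finV := have := G.finV; inferInstance
  finE := have := G.finE; inferInstance
  src e := ⟨G.src e.1, e.2.1⟩
  tgt e := ⟨G.tgt e.1, e.2.2⟩
  vty x := G.vty x.1
  ety e := G.ety e.1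
  src_ty e := G.src_ty e.1
  tgt_ty e := G.tgt_ty e.1
  tag x := G.tag x.1
  tag_bang x := G.tag_bang x.1

open Classical in
/-- The vertex of the second copy of `G` in `G.dup S` corresponding to `x`. -/
noncomputable def second (S : Set G.V) (x : G.V) : G.V ⊕ {x : G.V // x ∈ S} :=
  if h : x ∈ S then .inr ⟨x, h⟩ else .inl x

/-- Two copies of `G` glued along the full subgraph `G ∖ S`, i.e. the pushout of the inclusion
`G ∖ S → G` with itself: `.inl` is the first copy of `G`, and `.inr` is the part of the second copy
that is not in `G ∖ S`. -/
noncomputable def dup (S : Set G.V) : Graph T Tag where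
  V := G.V ⊕ {x : G.V // x ∈ S}
  E := G.E ⊕ {e : G.E // G.src e ∈ S ∨ G.tgt e ∈ S}
  finV := have := G.finV; inferInstance
  finE := have := G.finE; inferInstance
  src := Sum.elim (fun e => .inl (G.src e)) (fun e => G.second S (G.src e.1))
  tgt := Sum.elim (fun e => .inl (G.tgt e)) (fun e => G.second S (G.tgt e.1))
  vty := Sum.elim G.vty (fun x => G.vty x.1)
  ety := Sum.elim G.ety (fun e => G.ety e.1)
  src_ty := by
    rintro (e | e)
    · exact G.src_ty e
    · simp only [Sum.elim_inr, second]
      split_ifs <;> exact G.src_ty e.1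
  tgt_ty := by
    rintro (e | e)
    · exact G.tgt_ty e
    · simp only [Sum.elim_inr, second]
      split_ifs <;> exact G.tgt_ty e.1
  tag := Sum.elim G.tag (fun x => G.tag x.1)
  tag_bang := by
    rintro (x | x)
    · exact G.tag_bang x
    · exact G.tag_bang x.1

noncomputable def copy (b : G.Bang) : Graph T Tag := G.dup (G.box b)

def drop (b : G.Bang) : Graph T Tag := G.del {b.1}

def kill (b : G.Bang) : Graph T Tag := G.del (G.box b)

open Classical in
/-- `G` with the `!`-vertex `b` being `x`-fixed. -/
noncomputable def fix (b : G.Bang) (x : Tag) : Graph T Tag :=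
  { G with
    tag := fun y => if y = b.1 then some x else G.tag y
    tag_bang := by
      intro y hy
      by_cases h : y = b.1
      · rw [h]; exact b.2
      · rw [if_neg h] at hy; exact G.tag_bang y hy }

end Graph

/-- Monomorphisms of typed graphs that reflect `!`-box containment and preserve and reflect fixing
tags. Between concrete graphs these are just the monomorphisms. -/
@[ext]
structure Emb (G H : Graph T Tag) where
  fV : G.V → H.V
  fE : G.E → H.E
  map_src : ∀ e, H.src (fE e) = fV (G.src e)
  map_tgt : ∀ e, H.tgt (fE e) = fV (G.tgt e)
  map_vty : ∀ x, H.vty (fV x) = G.vty x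
  map_ety : ∀ e, H.ety (fE e) = G.ety e
  map_tag : ∀ x, H.tag (fV x) = G.tag x
  injV : Function.Injective fV
  injE : Function.Injective fE
  reflects : ∀ (e : H.E) (x : G.V), H.IsBang (H.src e) → H.tgt e = fV x → ∃ e', fE e' = e

namespace Emb

variable {G H K : Graph T Tag}

def comp (g : Emb H K) (f : Emb G H) : Emb G K where
  fV := g.fV ∘ f.fV
  fE := g.fE ∘ f.fE
  map_src e := by simp [g.map_src, f.map_src]
  map_tgt e := by simp [g.map_tgt, f.map_tgt]
  map_vty x := by simp [g.map_vty, f.map_vty]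
  map_ety e := by simp [g.map_ety, f.map_ety]
  map_tag x := by simp [g.map_tag, f.map_tag]
  injV := g.injV.comp f.injV
  injE := g.injE.comp f.injE
  reflects e x hb ht := by
    obtain ⟨e', rfl⟩ := g.reflects e (f.fV x) hb ht
    have hb' : H.IsBang (H.src e') := by
      rw [Graph.IsBang, g.map_src, g.map_vty] at hb; exact hb
    have ht' : H.tgt e' = f.fV x := by
      rw [g.map_tgt] at ht; exact g.injV ht
    obtain ⟨e'', rfl⟩ := f.reflects e' x hb' ht'
    exact ⟨e'', rfl⟩

/-- The image of a `!`-vertex. -/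
def bang (f : Emb G H) (b : G.Bang) : H.Bang :=
  ⟨f.fV b.1, by rw [Graph.IsBang, f.map_vty]; exact b.2⟩

/-- An isomorphism of typed (and tagged) graphs. -/
def IsIso (f : Emb G H) : Prop := Function.Bijective f.fV ∧ Function.Bijective f.fE

theorem mem_box_iff (f : Emb G H) (b : G.Bang) (x : G.V) :
    f.fV x ∈ H.box (f.bang b).1 ↔ x ∈ G.box b.1 := by
  constructor
  · rintro (h | ⟨e, hs, ht⟩)
    · exact Or.inl (f.injV h)
    · obtain ⟨e', rfl⟩ := f.reflects e x (by rw [hs]; exact (f.bang b).2) ht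
      refine Or.inr ⟨e', f.injV ?_, f.injV ?_⟩
      · rw [← f.map_src, hs]; rfl
      · rw [← f.map_tgt, ht]
  · rintro (h | ⟨e, hs, ht⟩)
    · exact Or.inl (by rw [h]; rfl)
    · exact Or.inr ⟨f.fE e, by rw [f.map_src, hs]; rfl, by rw [f.map_tgt, ht]⟩

/-- The restriction of `f` to `G ∖ S → H ∖ S'`. -/
def del (f : Emb G H) (S : Set G.V) (S' : Set H.V) (h : ∀ x, f.fV x ∈ S' ↔ x ∈ S) :
    Emb (G.del S) (H.del S') where
  fV x := ⟨f.fV x.1, fun hx => x.2 ((h _).1 hx)⟩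
  fE e := ⟨f.fE e.1, by
    rw [f.map_src, f.map_tgt, h, h]; exact e.2⟩
  map_src e := Subtype.ext (f.map_src e.1)
  map_tgt e := Subtype.ext (f.map_tgt e.1)
  map_vty x := f.map_vty x.1
  map_ety e := f.map_ety e.1
  map_tag x := f.map_tag x.1
  injV x y hxy := Subtype.ext (f.injV (congrArg Subtype.val hxy))
  injE x y hxy := Subtype.ext (f.injE (congrArg Subtype.val hxy))
  reflects e x hb ht := by
    obtain ⟨e', he'⟩ := f.reflects e.1 x.1 hb (congrArg Subtype.val ht)
    refine ⟨⟨e', ?_⟩, Subtype.ext he'⟩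
    rw [← h, ← h, ← f.map_src, ← f.map_tgt, he']
    exact e.2

theorem map_second (f : Emb G H) (S : Set G.V) (S' : Set H.V) (h : ∀ x, f.fV x ∈ S' ↔ x ∈ S)
    (x : G.V) : H.second S' (f.fV x) =
      Sum.map f.fV (fun y : {y : G.V // y ∈ S} => (⟨f.fV y.1, (h _).2 y.2⟩ : {y // y ∈ S'}))
        (G.second S x) := by
  by_cases hx : x ∈ S
  · simp [Graph.second, hx, h]
  · simp [Graph.second, hx, h]

theorem second_injective (S : Set G.V) : Function.Injective (G.second S) := by
  intro x y hxy
  unfold Graph.second at hxy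
  split_ifs at hxy with h1 h2 h2
  · exact congrArg Subtype.val (Sum.inr_injective hxy)
  · exact Sum.inl_injective hxy

/-- The map `G.dup S → H.dup S'` that is `f` on both copies. -/
noncomputable def dup (f : Emb G H) (S : Set G.V) (S' : Set H.V)
    (h : ∀ x, f.fV x ∈ S' ↔ x ∈ S) : Emb (G.dup S) (H.dup S') where
  fV := Sum.map f.fV (fun y => ⟨f.fV y.1, (h _).2 y.2⟩)
  fE := Sum.map f.fE (fun e => ⟨f.fE e.1, by rw [f.map_src, f.map_tgt, h, h]; exact e.2⟩)
  map_src := by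
    rintro (e | e)
    · exact congrArg Sum.inl (f.map_src e)
    · change H.second S' (H.src (f.fE e.1)) = _
      rw [f.map_src, f.map_second S S' h]; rfl
  map_tgt := by
    rintro (e | e)
    · exact congrArg Sum.inl (f.map_tgt e)
    · change H.second S' (H.tgt (f.fE e.1)) = _
      rw [f.map_tgt, f.map_second S S' h]; rfl
  map_vty := by
    rintro (x | x)
    · exact f.map_vty x
    · exact f.map_vty x.1
  map_ety := by
    rintro (e | e)
    · exact f.map_ety e
    · exact f.map_ety e.1
  map_tag := by
    rintro (x | x)
    · exact f.map_tag x
    · exact f.map_tag x.1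
  injV := Sum.map_injective.2 ⟨f.injV, fun x y hxy =>
    Subtype.ext (f.injV (congrArg Subtype.val hxy))⟩
  injE := Sum.map_injective.2 ⟨f.injE, fun x y hxy =>
    Subtype.ext (f.injE (congrArg Subtype.val hxy))⟩
  reflects := by
    have key : ∀ (z : H.V) (x : (G.dup S).V), H.second S' z =
        Sum.map f.fV (fun y : {y : G.V // y ∈ S} =>
          (⟨f.fV y.1, (h _).2 y.2⟩ : {y // y ∈ S'})) x → ∃ y : G.V, z = f.fV y := by
      rintro z (x | x) hz
      · unfold Graph.second at hz
        split_ifs at hz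
        · cases hz
        · exact ⟨x, Sum.inl_injective hz⟩
      · unfold Graph.second at hz
        split_ifs at hz
        · exact ⟨x.1, congrArg Subtype.val (Sum.inr_injective hz)⟩
        · cases hz
    rintro (e | e) x hb ht
    · rcases x with x | x
      · obtain ⟨e', rfl⟩ := f.reflects e x hb (Sum.inl_injective ht)
        exact ⟨.inl e', rfl⟩
      · cases ht
    · obtain ⟨y, hy⟩ := key _ x ht
      have hb' : H.IsBang (H.src e.1) := by
        have hb2 := (H.dup S').src_ty (.inr e)
        have hb3 : (H.dup S').vty ((H.dup S').src (.inr e)) = .bang := hb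
        rw [Graph.IsBang, H.src_ty]
        exact hb2.symm.trans hb3
      obtain ⟨e', he'⟩ := f.reflects e.1 y hb' hy
      refine ⟨.inr ⟨e', ?_⟩, congrArg Sum.inr (Subtype.ext he')⟩
      rw [← h, ← h, ← f.map_src, ← f.map_tgt, he']
      exact e.2

noncomputable def copy (f : Emb G H) (b : G.Bang) : Emb (G.copy b) (H.copy (f.bang b)) :=
  f.dup _ _ (f.mem_box_iff b)

def kill (f : Emb G H) (b : G.Bang) : Emb (G.kill b) (H.kill (f.bang b)) :=
  f.del _ _ (f.mem_box_iff b)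

def drop (f : Emb G H) (b : G.Bang) : Emb (G.drop b) (H.drop (f.bang b)) :=
  f.del _ _ (fun _ => f.injV.eq_iff)

noncomputable def fix (f : Emb G H) (b : G.Bang) (x : Tag) :
    Emb (G.fix b x) (H.fix (f.bang b) x) where
  fV := f.fV
  fE := f.fE
  map_src := f.map_src
  map_tgt := f.map_tgt
  map_vty := f.map_vty
  map_ety := f.map_ety
  map_tag y := by
    have h : f.fV y = (f.bang b).1 ↔ y = b.1 := f.injV.eq_iff
    by_cases hy : y = b.1
    · exact (if_pos (h.2 hy)).trans (if_pos hy).symm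
    · exact (if_neg (fun h' => hy (h.1 h'))).trans ((f.map_tag y).trans (if_neg hy).symm)
  injV := f.injV
  injE := f.injE
  reflects := f.reflects

end Emb

/-- A span `L ← I → R`. -/
structure Span (T : Signature.{u, v}) (Tag : Type w) where
  L : Graph T Tag
  I : Graph T Tag
  R : Graph T Tag
  left : Emb I L
  right : Emb I R

namespace Span

variable (e : Span T Tag)

/-- The image of `i : I → G` is `Bound_!(G)`: the subgraph of all `!`-vertices and all boundary
vertices, with the edges from `!`-vertices to such vertices. -/
def HasBoundaryImage {I G : Graph T Tag} (i : Emb I G) : Prop :=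
  (∀ x : G.V, (∃ y, i.fV y = x) ↔ (G.IsBang x ∨ G.IsBoundary x)) ∧
  (∀ a : G.E, (∃ c, i.fE c = a) ↔
    (G.IsBang (G.src a) ∧ (G.IsBang (G.tgt a) ∨ G.IsBoundary (G.tgt a))))

/-- `L ← I → R` is a `!`-graph equation whose fixed `!`-vertices are top-level. The isomorphisms
`Bound_!(L) ≅ I ≅ Bound_!(R)`, `In_!(L) ≅ In_!(R)` and `Out_!(L) ≅ Out_!(R)` of the commuting
diagram are forced to be those induced by the two legs, so that they exist exactly if each
leg has image the boundary and the legs agree on what is an input and what is an output. -/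
structure IsEquation : Prop where
  bangL : e.L.IsBangGraph
  bangI : e.I.IsBangGraph
  bangR : e.R.IsBangGraph
  isolatedL : e.L.NoIsolatedWires
  isolatedR : e.R.NoIsolatedWires
  boundL : HasBoundaryImage e.left
  boundR : HasBoundaryImage e.right
  input_iff : ∀ y, e.L.IsInput (e.left.fV y) ↔ e.R.IsInput (e.right.fV y)
  output_iff : ∀ y, e.L.IsOutput (e.left.fV y) ↔ e.R.IsOutput (e.right.fV y)
  fixed_topLevel : ∀ b, e.I.tag b ≠ none → e.I.TopLevel b

def Concrete : Prop := e.L.Concrete ∧ e.R.Concrete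

/-- String graph equations are the concrete `!`-graph equations. -/
def IsStringEquation : Prop := e.IsEquation ∧ e.Concrete

noncomputable def copy (b : e.I.Bang) : Span T Tag :=
  ⟨e.L.copy (e.left.bang b), e.I.copy b, e.R.copy (e.right.bang b), e.left.copy b, e.right.copy b⟩

def drop (b : e.I.Bang) : Span T Tag :=
  ⟨e.L.drop (e.left.bang b), e.I.drop b, e.R.drop (e.right.bang b), e.left.drop b, e.right.drop b⟩

def kill (b : e.I.Bang) : Span T Tag :=
  ⟨e.L.kill (e.left.bang b), e.I.kill b, e.R.kill (e.right.bang b), e.left.kill b, e.right.kill b⟩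

noncomputable def fix (b : e.I.Bang) (x : Tag) : Span T Tag :=
  ⟨e.L.fix (e.left.bang b) x, e.I.fix b x, e.R.fix (e.right.bang b) x,
    e.left.fix b x, e.right.fix b x⟩

/-- The copy `b⁰` of `b` in `COPY_b`. -/
def copy0 (b : e.I.Bang) : (e.copy b).I.Bang := ⟨.inl b.1, b.2⟩

/-- The copy `b¹` of `b` in `COPY_b`. -/
def copy1 (b : e.I.Bang) : (e.copy b).I.Bang := ⟨.inr ⟨b.1, Or.inl rfl⟩, b.2⟩

/-- `EXP_b` is `COPY_b; DROP_{b¹}`. -/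
noncomputable def exp (b : e.I.Bang) : Span T Tag := (e.copy b).drop (e.copy1 b)

/-- The `!`-vertex `b⁰` of `EXP_b`, which is again called `b`. -/
def keep (b : e.I.Bang) : (e.exp b).I.Bang :=
  ⟨⟨(e.copy0 b).1, by rintro ⟨⟩⟩, b.2⟩

/-- `n` operations `EXP_b` followed by one `KILL_b`. -/
noncomputable def expKill : ℕ → (e : Span T Tag) → e.I.Bang → Span T Tag
  | 0, e, b => e.kill b
  | n + 1, e, b => expKill n (e.exp b) (e.keep b)

/-- Isomorphism of spans. -/
def Iso (e e' : Span T Tag) : Prop :=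
  ∃ (l : Emb e.L e'.L) (m : Emb e.I e'.I) (r : Emb e.R e'.R),
    l.IsIso ∧ m.IsIso ∧ r.IsIso ∧
    l.comp e.left = e'.left.comp m ∧ r.comp e.right = e'.right.comp m

/-- `Instance e e'`: the span `e'` is obtained from `e`, up to isomorphism, by applying zero or
more `!`-box operations. -/
inductive Instance : Span T Tag → Span T Tag → Prop
  | iso {e e'} : e.Iso e' → Instance e e'
  | copy {e e'} (b : e.I.Bang) : Instance (e.copy b) e' → Instance e e'
  | drop {e e'} (b : e.I.Bang) : Instance (e.drop b) e' → Instance e e'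
  | kill {e e'} (b : e.I.Bang) : Instance (e.kill b) e' → Instance e e'

/-- The tags of the fixed `!`-vertices. -/
def tags : Set Tag := {x | ∃ b, e.I.tag b = some x}

/-- `FixedExpansion lam e e'`: the span `e'` is (up to isomorphism) `X_lam(e)`, the result of
applying, for each tag `x` and each `x`-fixed `!`-vertex `b` of `e`, in some order, `lam x`
operations `EXP_b` and one `KILL_b`. Only the values of `lam` on the tags of `e` matter. -/
inductive FixedExpansion (lam : Tag → ℕ) : Span T Tag → Span T Tag → Prop
  | done {e e'} : (∀ b, e.I.tag b = none) → e.Iso e' → FixedExpansion lam e e'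
  | step {e e'} (b : e.I.Bang) (x : Tag) : e.I.tag b.1 = some x →
      FixedExpansion lam (expKill (lam x) e b) e' → FixedExpansion lam e e'

end Span

/-- A commuting square of monomorphisms is a pushout (a union with intersection the common
subgraph): the images of `m` and `g` cover `K`, and meet exactly in the image of `I`. -/
structure IsPushout {I G D K : Graph T Tag} (i : Emb I G) (d : Emb I D) (m : Emb G K)
    (g : Emb D K) : Prop where
  comm : m.comp i = g.comp d
  coverV : ∀ x, (∃ y, m.fV y = x) ∨ ∃ y, g.fV y = x
  coverE : ∀ a, (∃ c, m.fE c = a) ∨ ∃ c, g.fE c = a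
  meetV : ∀ x y, m.fV x = g.fV y → ∃ z, i.fV z = x ∧ d.fV z = y
  meetE : ∀ a c, m.fE a = g.fE c → ∃ z, i.fE z = a ∧ d.fE z = c

/-- The wires of a string graph without isolated wire-vertices, each given by its set of edges:
two edges belong to the same wire if they are linked by a chain of edges that are consecutive
at wire-vertices. -/
def Wire (G : Graph T Tag) : Type :=
  Quot (fun a c : G.E => G.tgt a = G.src c ∧ G.IsWire (G.tgt a))

def Graph.wire (G : Graph T Tag) (a : G.E) : Wire G := Quot.mk _ a

/-- A wire homeomorphism between string graphs: type-preserving bijections on node-vertices,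
boundary vertices and wires that respect the sources and targets of wires, and the types of the
edges by which wires are attached to node-vertices. -/
structure WireHomeo (G H : Graph T Tag) where
  node : {x // G.IsNode x} ≃ {x // H.IsNode x}
  bound : {x // G.IsBoundary x} ≃ {x // H.IsBoundary x}
  wire : Wire G ≃ Wire H
  node_ty : ∀ x, H.vty (node x).1 = G.vty x.1
  bound_ty : ∀ x, H.vty (bound x).1 = G.vty x.1
  wire_ty : ∀ a c, wire (G.wire a) = H.wire c → (H.ety c).obj = (G.ety a).obj
  node_src : ∀ k x t, (∃ a, G.wire a = k ∧ G.src a = x.1 ∧ G.ety a = t) ↔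
    ∃ a, H.wire a = wire k ∧ H.src a = (node x).1 ∧ H.ety a = t
  node_tgt : ∀ k x t, (∃ a, G.wire a = k ∧ G.tgt a = x.1 ∧ G.ety a = t) ↔
    ∃ a, H.wire a = wire k ∧ H.tgt a = (node x).1 ∧ H.ety a = t
  bound_src : ∀ k x, (∃ a, G.wire a = k ∧ G.src a = x.1) ↔
    ∃ a, H.wire a = wire k ∧ H.src a = (bound x).1
  bound_tgt : ∀ k x, (∃ a, G.wire a = k ∧ G.tgt a = x.1) ↔
    ∃ a, H.wire a = wire k ∧ H.tgt a = (bound x).1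

/-- The equational logic of string graphs over a set `S` of axioms. -/
inductive StringDerivable (S : Set (Span T Tag)) : Span T Tag → Prop
  | ax {e} : e ∈ S → StringDerivable S e
  | refl {G I : Graph T Tag} (i : Emb I G) :
      Span.IsStringEquation ⟨G, I, G, i, i⟩ → StringDerivable S ⟨G, I, G, i, i⟩
  | symm {G I H : Graph T Tag} {i : Emb I G} {j : Emb I H} :
      StringDerivable S ⟨G, I, H, i, j⟩ → StringDerivable S ⟨H, I, G, j, i⟩
  /-- Here `t` is `k⁻¹ ∘ j`. -/
  | trans {G I H J K : Graph T Tag} {i : Emb I G} {j : Emb I H} {k : Emb J H} {l : Emb J K}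
      (t : Emb I J) : k.comp t = j →
      StringDerivable S ⟨G, I, H, i, j⟩ → StringDerivable S ⟨H, J, K, k, l⟩ →
      StringDerivable S ⟨G, I, K, i, l.comp t⟩
  | leibniz {G I H G' D H' I' : Graph T Tag} {i : Emb I G} {j : Emb I H}
      (m : Emb G G') (d : Emb I D) (r : Emb H H') (g : Emb D G') (h : Emb D H') (c : Emb I' D) :
      D.IsString → D.Concrete → IsPushout i d m g → IsPushout j d r h →
      Span.IsStringEquation ⟨G', I', H', g.comp c, h.comp c⟩ →
      StringDerivable S ⟨G, I, H, i, j⟩ →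
      StringDerivable S ⟨G', I', H', g.comp c, h.comp c⟩
  | homeo {G I H G' H' : Graph T Tag} {i : Emb I G} {j : Emb I H} {i' : Emb I G'} {j' : Emb I H'}
      (φ : WireHomeo G G') (ψ : WireHomeo H H') :
      (∀ y (hy : G.IsBoundary (i.fV y)), (φ.bound ⟨i.fV y, hy⟩).1 = i'.fV y) →
      (∀ y (hy : H.IsBoundary (j.fV y)), (ψ.bound ⟨j.fV y, hy⟩).1 = j'.fV y) →
      Span.IsStringEquation ⟨G', I, H', i', j'⟩ →
      StringDerivable S ⟨G, I, H, i, j⟩ → StringDerivable S ⟨G', I, H', i', j'⟩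

/-- The set of concrete instances of the equations in `S`. -/
def concreteInstances (S : Set (Span T Tag)) : Set (Span T Tag) :=
  {f | ∃ e ∈ S, e.Instance f ∧ f.Concrete}

/-- `E_lam`, for `lam` a function on the set `A` of tags: all `X_lam(e)` where `e ∈ E` has no
fixed `!`-vertices with tags outside `A`. -/
def expandedAxioms (E : Set (Span T Tag)) (A : Set Tag) (lam : Tag → ℕ) : Set (Span T Tag) :=
  {f | ∃ e ∈ E, e.tags ⊆ A ∧ e.FixedExpansion lam f}

/-- The semantics of `E ⊢ e`: for every function `lam` from the tags of `e` to the natural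
numbers, every concrete instance of `X_lam(e)` is derivable in the equational logic of string
graphs from the concrete instances of the equations in `E_lam`. -/
def Entails (E : Set (Span T Tag)) (e : Span T Tag) : Prop :=
  ∀ (lam : Tag → ℕ) (f g : Span T Tag), e.FixedExpansion lam f → f.Instance g → g.Concrete →
    StringDerivable (concreteInstances (expandedAxioms E e.tags lam)) g

end BangGraph

/-!
The idea is to describe all concrete instances of a `!`-graph equation at once, without reference
to the order in which the `!`-box operations are applied. The `!`-vertices of `e` form a poset, and
a finite presheaf `F` on it (`BoxFam`) says how often each `!`-box is to be instantiated inside each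
instantiation of the `!`-boxes around it. Then `e.inst F` has one copy of each vertex and edge for
each compatible family of instantiations of the `!`-boxes around it. The concrete instances of `e`
are, up to isomorphism, exactly the spans `e.inst F` (`Instance.exists_inst`,
`Good.instance_inst`), and those of `X_lam(e)` are the ones where the fibre of `F` over each
`y`-fixed `!`-vertex has `lam y` elements (`FixedExpansion.exists_inst`,
`Good.exists_fixedExpansion`). So all questions on commuting `!`-box operations disappear.

The `!`-box operations act on presheaves as follows. Instantiating `KILL_b(e)` is instantiating `e`
by a presheaf which is empty over `b`. Instantiating `COPY_b(e)` is instantiating `e` by the pushed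
forward presheaf, whose fibre over `b` is the union of the fibres over `b⁰` and `b¹`. Instantiating
`DROP_b(e)` is instantiating `e` by a presheaf that has exactly one element over `b` in each
compatible family of instantiations of the boxes around `b`. Hence, for a top-level `b`, the fibre
over `b` loses one element in passing to `EXP_b(e)` (`ExpRel`).

Now let `g` be a concrete instance of `X_lam(e)`, say `g ≅ e.inst F`, and let `n` be the number of
elements of `F` over `b`. Then `g` is a concrete instance of `FIX^x_b(e)` expanded with `n` as the
value at `x`. That such `g` are derivable follows by induction on `n`. If `n = 0` then `g` is a
concrete instance of `X_lam(KILL_b(e))`, and the base case applies. The spans with value `n + 1` at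
`x` are concrete instances of `FIX^x_b(EXP_b(e))` expanded with value `n`, so that the step case
makes them derivable from concrete instances of `E`, in which `x` does not occur, and of
`FIX^x_b(e)` with value `n`. The latter are derivable by the induction hypothesis and can be cut
(`StringDerivable.cut`).
-/

namespace BangGraph

variable {T : Signature.{u, v}} {Tag : Type w}

/-! ### Containment of `!`-boxes -/

namespace Graph

variable {G : Graph T Tag}

/-- The laws of the containment relation between `!`-boxes: it is transitive and antisymmetric. -/
structure Nested (G : Graph T Tag) : Prop where
  nest : ∀ b b', G.IsBang b → G.IsBang b' → b' ∈ G.box b → G.box b' ⊆ G.box b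
  anti : ∀ b b', G.IsBang b → G.IsBang b' → b' ∈ G.box b → b ∈ G.box b' → b = b'

theorem IsBangGraph.nested (h : G.IsBangGraph) : G.Nested where
  nest := h.nesting
  anti := by
    rintro b b' hb hb' (h1 | ⟨e, h1, h2⟩) (h3 | ⟨e', h3, h4⟩)
    · exact h1.symm
    · exact h1.symm
    · exact h3
    · rw [← h1, ← h2]
      exact h.antisymm e e' (h1 ▸ hb) (h2 ▸ hb') (h1.trans h4.symm) (h2.trans h3.symm)

theorem mem_box_self (b : G.V) : b ∈ G.box b := Or.inl rfl

/-- A vertex that lies in no `!`-box except possibly its own. -/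
def IsTop (G : Graph T Tag) (b : G.V) : Prop := ∀ c, G.IsBang c → b ∈ G.box c → c = b

theorem TopLevel.isTop {b : G.V} (h : G.TopLevel b) : G.IsTop b := by
  rintro c - (h1 | ⟨e, h1, h2⟩)
  · exact h1.symm
  · rw [← h1, h e h2]

/-- A maximal `!`-box belongs to a `!`-vertex lying in no other `!`-box. -/
theorem Nested.exists_isTop (h : G.Nested) (hG : ∃ b, G.IsBang b) :
    ∃ b, G.IsBang b ∧ G.IsTop b := by
  have := G.finV
  obtain ⟨b, hb, hmax⟩ := Set.exists_max_image {b | G.IsBang b} (fun b => (G.box b).ncard)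
    (Set.toFinite _) hG
  refine ⟨b, hb, fun c hc hbc => ?_⟩
  have hsub := h.nest c b hc hb hbc
  have heq : G.box b = G.box c := Set.eq_of_subset_of_ncard_le hsub (hmax c hc)
  exact h.anti c b hc hb hbc (heq ▸ mem_box_self c)

theorem IsPlain.tgt {a : G.E} (h : G.IsPlain a) : ¬ G.IsBang (G.tgt a) := by
  unfold IsPlain IsBang at *
  rw [G.src_ty] at h
  rw [G.tgt_ty]
  cases ha : G.ety a <;> simp_all [ETy.src, ETy.tgt]

theorem mem_box_del {S : Set G.V} (x b : (G.del S).V) :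
    x ∈ (G.del S).box b ↔ x.1 ∈ G.box b.1 := by
  constructor
  · rintro (h | ⟨e, hs, ht⟩)
    · exact Or.inl (congrArg Subtype.val h)
    · exact Or.inr ⟨e.1, congrArg Subtype.val hs, congrArg Subtype.val ht⟩
  · rintro (h | ⟨e, hs, ht⟩)
    · exact Or.inl (Subtype.ext h)
    · exact Or.inr ⟨⟨e, by rw [hs]; exact b.2, by rw [ht]; exact x.2⟩,
        Subtype.ext hs, Subtype.ext ht⟩

theorem Nested.del (h : G.Nested) (S : Set G.V) : (G.del S).Nested where
  nest b b' hb hb' hm x hx := by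
    rw [mem_box_del] at *
    exact h.nest b.1 b'.1 hb hb' hm hx
  anti b b' hb hb' h1 h2 := by
    rw [mem_box_del] at *
    exact Subtype.ext (h.anti b.1 b'.1 hb hb' h1 h2)

theorem IsTop.del {S : Set G.V} {b : (G.del S).V} (h : G.IsTop b.1) : (G.del S).IsTop b := by
  intro c hc hm
  rw [mem_box_del] at hm
  exact Subtype.ext (h c.1 hc hm)

/-! ### Containment of `!`-boxes in `COPY_b` -/

/-- The vertex of `G` of which a vertex of `G.copy b` is a copy. -/
noncomputable def base {b : G.Bang} : (G.copy b).V → G.V := Sum.elim id Subtype.val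

/-- The edge of `G` of which an edge of `G.copy b` is a copy. -/
noncomputable def baseE {b : G.Bang} : (G.copy b).E → G.E := Sum.elim id Subtype.val

theorem second_of_mem {S : Set G.V} {x : G.V} (h : x ∈ S) : G.second S x = .inr ⟨x, h⟩ := by
  simp [second, h]

theorem base_second {b : G.Bang} (x : G.V) : base (b := b) (G.second (G.box b.1) x) = x := by
  unfold second
  split_ifs <;> rfl

theorem base_src {b : G.Bang} (a : (G.copy b).E) :
    base ((G.copy b).src a) = G.src (baseE a) := by
  rcases a with a | a
  · rfl
  · exact base_second _

theorem base_tgt {b : G.Bang} (a : (G.copy b).E) :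
    base ((G.copy b).tgt a) = G.tgt (baseE a) := by
  rcases a with a | a
  · rfl
  · exact base_second _

/-- An endpoint of an edge of `G.copy b` that is a copy of a vertex of `B(b)` belongs to the same
copy of `G` as the edge. Here and below the vertices and edges of `G.copy b` shared by the two
copies of `G` count as belonging to the first one. -/
theorem isRight_src {b : G.Bang} (a : (G.copy b).E) (h : G.src (baseE a) ∈ G.box b.1) :
    Sum.isRight ((G.copy b).src a) = Sum.isRight a := by
  rcases a with a | a
  · rfl
  · change G.src a.1 ∈ G.box b.1 at h
    change Sum.isRight (G.second (G.box b.1) (G.src a.1)) = _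
    rw [second_of_mem h]; rfl

theorem isRight_tgt {b : G.Bang} (a : (G.copy b).E) (h : G.tgt (baseE a) ∈ G.box b.1) :
    Sum.isRight ((G.copy b).tgt a) = Sum.isRight a := by
  rcases a with a | a
  · rfl
  · change G.tgt a.1 ∈ G.box b.1 at h
    change Sum.isRight (G.second (G.box b.1) (G.tgt a.1)) = _
    rw [second_of_mem h]; rfl

theorem vty_base {b : G.Bang} (x : (G.copy b).V) : G.vty (base x) = (G.copy b).vty x := by
  rcases x with x | x <;> rfl

theorem isBang_base {b : G.Bang} {x : (G.copy b).V} :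
    G.IsBang (base x) ↔ (G.copy b).IsBang x := by
  unfold IsBang; rw [vty_base]

/-- A vertex of `G.copy b` is determined by the vertex it is a copy of, and by the copy of `G` it
lies in, where the latter matters only on `B(b)`. -/
theorem copy_ext {b : G.Bang} {x y : (G.copy b).V} (h : base x = base y)
    (hs : base x ∈ G.box b.1 → Sum.isRight x = Sum.isRight y) : x = y := by
  rcases x with x | x <;> rcases y with y | y
  · exact congrArg _ h
  · have : x = y.1 := h
    have := hs (this ▸ y.2)
    simp at this
  · have := hs x.2
    simp at this
  · exact congrArg _ (Subtype.ext h)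

theorem copyE_ext {b : G.Bang} {x y : (G.copy b).E} (h : baseE x = baseE y)
    (hs : G.src (baseE x) ∈ G.box b.1 ∨ G.tgt (baseE x) ∈ G.box b.1 →
      Sum.isRight x = Sum.isRight y) : x = y := by
  rcases x with x | x <;> rcases y with y | y
  · exact congrArg _ h
  · have : x = y.1 := h
    have := hs (this ▸ y.2)
    simp at this
  · have := hs x.2
    simp at this
  · exact congrArg _ (Subtype.ext h)

theorem exists_copy_vertex {b : G.Bang} (x : G.V) (s : Bool) :
    ∃ x' : (G.copy b).V, base x' = x ∧ (x ∈ G.box b.1 → Sum.isRight x' = s) := by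
  by_cases h : x ∈ G.box b.1
  · cases s
    · exact ⟨.inl x, rfl, fun _ => rfl⟩
    · exact ⟨.inr ⟨x, h⟩, rfl, fun _ => rfl⟩
  · exact ⟨.inl x, rfl, fun h' => (h h').elim⟩

theorem exists_copy_edge {b : G.Bang} (a : G.E) (s : Bool) :
    ∃ a' : (G.copy b).E, baseE a' = a ∧
      (G.src a ∈ G.box b.1 ∨ G.tgt a ∈ G.box b.1 → Sum.isRight a' = s) := by
  by_cases h : G.src a ∈ G.box b.1 ∨ G.tgt a ∈ G.box b.1
  · cases s
    · exact ⟨.inl a, rfl, fun _ => rfl⟩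
    · exact ⟨.inr ⟨a, h⟩, rfl, fun _ => rfl⟩
  · exact ⟨.inl a, rfl, fun h' => (h h').elim⟩

/-- Containment in the `!`-boxes of `COPY_b`: the two copies of a `!`-vertex in `B(b)` contain the
vertices of their own copy of `B(b)` only. -/
theorem mem_box_copy (hG : G.Nested) {b : G.Bang} {c x : (G.copy b).V}
    (hc : (G.copy b).IsBang c) :
    x ∈ (G.copy b).box c ↔
      base x ∈ G.box (base c) ∧ (base c ∈ G.box b.1 → Sum.isRight x = Sum.isRight c) := by
  constructor
  · rintro (rfl | ⟨a, rfl, rfl⟩)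
    · exact ⟨mem_box_self _, fun _ => rfl⟩
    · have hm : base ((G.copy b).tgt a) ∈ G.box (base ((G.copy b).src a)) := by
        rw [base_tgt, base_src]; exact Or.inr ⟨_, rfl, rfl⟩
      refine ⟨hm, fun h => ?_⟩
      have h2 := hG.nest b.1 _ b.2 (isBang_base.2 hc) h hm
      rw [base_src] at h
      rw [base_tgt] at h2
      rw [isRight_src a h, isRight_tgt a h2]
  · rintro ⟨h | ⟨a, hs, ht⟩, h2⟩
    · exact Or.inl (copy_ext h (fun h3 => h2 (h ▸ h3)))
    · obtain ⟨a', rfl, ha'⟩ := exists_copy_edge (b := b) a (Sum.isRight x)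
      refine Or.inr ⟨a', copy_ext ((base_src a').trans hs) fun h3 => ?_,
        copy_ext ((base_tgt a').trans ht) fun h3 => ?_⟩
      · rw [base_src] at h3
        rw [isRight_src a' h3, ha' (Or.inl h3), h2 (hs ▸ h3)]
      · rw [base_tgt] at h3
        rw [isRight_tgt a' h3, ha' (Or.inr h3)]

theorem Nested.copy (hG : G.Nested) (b : G.Bang) : (G.copy b).Nested where
  nest c d hc hd hm x hx := by
    rw [mem_box_copy hG hc] at hm ⊢
    rw [mem_box_copy hG hd] at hx
    have hc' := isBang_base.2 hc
    have hd' := isBang_base.2 hd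
    exact ⟨hG.nest _ _ hc' hd' hm.1 hx.1, fun h =>
      (hx.2 (hG.nest b.1 _ b.2 hc' h hm.1)).trans (hm.2 h)⟩
  anti c d hc hd h1 h2 := by
    rw [mem_box_copy hG hc] at h1
    rw [mem_box_copy hG hd] at h2
    have h3 := hG.anti _ _ (isBang_base.2 hc) (isBang_base.2 hd) h1.1 h2.1
    exact copy_ext h3 (fun h => (h1.2 h).symm)

theorem IsTop.copy (hG : G.Nested) {b : G.Bang} {c : (G.copy b).V}
    (h : G.IsTop (base c)) : (G.copy b).IsTop c := by
  intro d hd hm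
  rw [mem_box_copy hG hd] at hm
  have h3 := h _ (isBang_base.2 hd) hm.1
  exact copy_ext h3 (fun h => (hm.2 h).symm)

end Graph

/-! ### Embeddings and isomorphisms -/

namespace Emb

variable {G H : Graph T Tag}

theorem isBang_iff (f : Emb G H) {x : G.V} : H.IsBang (f.fV x) ↔ G.IsBang x := by
  unfold Graph.IsBang; rw [f.map_vty]

theorem mem_box (f : Emb G H) {b x : G.V} (hb : G.IsBang b) :
    f.fV x ∈ H.box (f.fV b) ↔ x ∈ G.box b :=
  f.mem_box_iff ⟨b, hb⟩ x

/-- An embedding identifies the boxes around a vertex with those around its image. -/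
theorem exists_of_mem_box (f : Emb G H) {c : H.V} {x : G.V} (hc : H.IsBang c)
    (h : f.fV x ∈ H.box c) : ∃ c', G.IsBang c' ∧ f.fV c' = c ∧ x ∈ G.box c' := by
  have key : ∃ c', f.fV c' = c := by
    rcases h with h | ⟨e, hs, ht⟩
    · exact ⟨x, h⟩
    · obtain ⟨e', rfl⟩ := f.reflects e x (hs ▸ hc) ht
      exact ⟨G.src e', by rw [← f.map_src, hs]⟩
  obtain ⟨c', rfl⟩ := key
  have hb := f.isBang_iff.1 hc
  exact ⟨c', hb, rfl, (f.mem_box hb).1 h⟩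

/-- The identity embedding. -/
def id (G : Graph T Tag) : Emb G G where
  fV x := x
  fE a := a
  map_src _ := rfl
  map_tgt _ := rfl
  map_vty _ := rfl
  map_ety _ := rfl
  map_tag _ := rfl
  injV _ _ h := h
  injE _ _ h := h
  reflects e _ _ _ := ⟨e, rfl⟩

theorem isIso_id : (id G).IsIso := ⟨Function.bijective_id, Function.bijective_id⟩

theorem IsIso.comp {K : Graph T Tag} {g : Emb H K} {f : Emb G H} (hg : g.IsIso) (hf : f.IsIso) :
    (g.comp f).IsIso := ⟨hg.1.comp hf.1, hg.2.comp hf.2⟩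

theorem IsIso.exists_inv {f : Emb G H} (hf : f.IsIso) :
    ∃ g : Emb H G, g.IsIso ∧ f.comp g = id H ∧ g.comp f = id G := by
  let eV := Equiv.ofBijective f.fV hf.1
  let eE := Equiv.ofBijective f.fE hf.2
  have hV : ∀ x, f.fV (eV.symm x) = x := eV.apply_symm_apply
  have hE : ∀ x, f.fE (eE.symm x) = x := eE.apply_symm_apply
  refine ⟨⟨eV.symm, eE.symm, ?_, ?_, ?_, ?_, ?_, eV.symm.injective, eE.symm.injective, ?_⟩,
    ⟨eV.symm.bijective, eE.symm.bijective⟩, ?_, ?_⟩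
  · exact fun e => f.injV (by rw [← f.map_src, hE, hV])
  · exact fun e => f.injV (by rw [← f.map_tgt, hE, hV])
  · exact fun x => by rw [← f.map_vty, hV]
  · exact fun x => by rw [← f.map_ety, hE]
  · exact fun x => by rw [← f.map_tag, hV]
  · exact fun e _ _ _ => ⟨f.fE e, f.injE (hE _)⟩
  · exact Emb.ext (funext hV) (funext hE)
  · exact Emb.ext (funext eV.symm_apply_apply) (funext eE.symm_apply_apply)

theorem comp_assoc {K M : Graph T Tag} (h : Emb K M) (g : Emb H K) (f : Emb G H) :
    (h.comp g).comp f = h.comp (g.comp f) := rfl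

theorem comp_id (f : Emb G H) : f.comp (id G) = f := rfl

theorem id_comp (f : Emb G H) : (id H).comp f = f := rfl

end Emb

namespace Span

variable {e e' e'' : Span T Tag}

theorem Iso.refl (e : Span T Tag) : e.Iso e :=
  ⟨_, _, _, Emb.isIso_id, Emb.isIso_id, Emb.isIso_id, rfl, rfl⟩

theorem Iso.trans (h : e.Iso e') (h' : e'.Iso e'') : e.Iso e'' := by
  obtain ⟨l, m, r, hl, hm, hr, h1, h2⟩ := h
  obtain ⟨l', m', r', hl', hm', hr', h1', h2'⟩ := h'
  refine ⟨l'.comp l, m'.comp m, r'.comp r, hl'.comp hl, hm'.comp hm, hr'.comp hr, ?_, ?_⟩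
  · rw [Emb.comp_assoc, h1, ← Emb.comp_assoc, h1', Emb.comp_assoc]
  · rw [Emb.comp_assoc, h2, ← Emb.comp_assoc, h2', Emb.comp_assoc]

theorem Iso.symm (h : e.Iso e') : e'.Iso e := by
  obtain ⟨l, m, r, hl, hm, hr, h1, h2⟩ := h
  obtain ⟨l', hl', hll, hll'⟩ := hl.exists_inv
  obtain ⟨m', hm', hmm, -⟩ := hm.exists_inv
  obtain ⟨r', hr', hrr, hrr'⟩ := hr.exists_inv
  refine ⟨l', m', r', hl', hm', hr', ?_, ?_⟩
  · calc l'.comp e'.left = l'.comp ((e'.left.comp m).comp m') := by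
          rw [Emb.comp_assoc, hmm, Emb.comp_id]
      _ = e.left.comp m' := by rw [← h1, ← Emb.comp_assoc, ← Emb.comp_assoc, hll', Emb.id_comp]
  · calc r'.comp e'.right = r'.comp ((e'.right.comp m).comp m') := by
          rw [Emb.comp_assoc, hmm, Emb.comp_id]
      _ = e.right.comp m' := by rw [← h2, ← Emb.comp_assoc, ← Emb.comp_assoc, hrr', Emb.id_comp]

theorem Instance.trans_iso (h : e.Instance e') (h' : e'.Iso e'') : e.Instance e'' := by
  induction h with
  | iso h => exact .iso (h.trans h')
  | copy b _ ih => exact .copy b (ih h')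
  | drop b _ ih => exact .drop b (ih h')
  | kill b _ ih => exact .kill b (ih h')

end Span

/-! ### Families of box instantiations -/

/-- A finite presheaf on the poset of `!`-vertices of `I`, which says how often each `!`-box is to
be instantiated inside each instantiation of the `!`-boxes around it. It is encoded by its total
space `X` with the projection to the `!`-vertices, where `rel y x` says that `x` restricts to `y`,
i.e. that the instantiation `x` takes place inside `y`. -/
structure BoxFam (I : Graph T Tag) where
  X : Type
  fin : Finite X
  proj : X → I.V
  rel : X → X → Prop
  bang : ∀ x, I.IsBang (proj x)
  rel_refl : ∀ x, rel x x
  rel_trans : ∀ {x y z}, rel z y → rel y x → rel z x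
  le : ∀ {x y}, rel y x → proj x ∈ I.box (proj y)
  lift : ∀ x a, I.IsBang a → proj x ∈ I.box a → ∃ y, rel y x ∧ proj y = a
  uniq : ∀ {x y y'}, rel y x → rel y' x → proj y = proj y' → y = y'

namespace BoxFam

variable {I I' : Graph T Tag}

/-- `κ` is a compatible family of instantiations of the `!`-boxes in `U`, one for each. It is closed
under restriction within `U` only, so that it can be restricted to any subset of `U`. -/
structure IsSec (F : BoxFam I) (U : Set I.V) (κ : Set F.X) : Prop where
  mem : ∀ x ∈ κ, F.proj x ∈ U
  ex : ∀ a ∈ U, ∃ x ∈ κ, F.proj x = a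
  inj : ∀ x ∈ κ, ∀ y ∈ κ, F.proj x = F.proj y → x = y
  closed : ∀ x ∈ κ, ∀ y, F.rel y x → F.proj y ∈ U → y ∈ κ

theorem IsSec.restrict {F : BoxFam I} {U U' : Set I.V} {κ : Set F.X} (h : F.IsSec U κ)
    (hU : U' ⊆ U) : F.IsSec U' (κ ∩ F.proj ⁻¹' U') where
  mem x hx := hx.2
  ex a ha := by
    obtain ⟨x, hx, rfl⟩ := h.ex a (hU ha)
    exact ⟨x, ⟨hx, ha⟩, rfl⟩
  inj x hx y hy := h.inj x hx.1 y hy.1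
  closed x hx y hy hyU := ⟨h.closed x hx.1 y hy (hU hyU), hyU⟩

/-- The fibre over a `!`-vertex. -/
def fib (F : BoxFam I) (b : I.V) : Set F.X := {x | F.proj x = b}

/-- The property of a map on vertices of being a discrete fibration of the posets of `!`-vertices:
it preserves containment, and the boxes around `p a` lift uniquely to boxes around `a`. -/
structure IsFibration (p : I'.V → I.V) : Prop where
  bang : ∀ a, I'.IsBang a → I.IsBang (p a)
  le : ∀ a c, I'.IsBang a → I'.IsBang c → a ∈ I'.box c → p a ∈ I.box (p c)
  lift : ∀ a c, I'.IsBang a → I.IsBang c → p a ∈ I.box c →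
    ∃ c', I'.IsBang c' ∧ p c' = c ∧ a ∈ I'.box c'
  uniq : ∀ a c d, I'.IsBang a → I'.IsBang c → I'.IsBang d → a ∈ I'.box c → a ∈ I'.box d →
    p c = p d → c = d

/-- The left Kan extension of a family along a discrete fibration: the total space is unchanged. -/
def push (F : BoxFam I') (p : I'.V → I.V) (hp : IsFibration p) : BoxFam I where
  X := F.X
  fin := F.fin
  proj x := p (F.proj x)
  rel := F.rel
  bang x := hp.bang _ (F.bang x)
  rel_refl := F.rel_refl
  rel_trans := F.rel_trans
  le h := hp.le _ _ (F.bang _) (F.bang _) (F.le h)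
  lift x a ha h := by
    obtain ⟨c, hc, rfl, hm⟩ := hp.lift _ a (F.bang x) ha h
    obtain ⟨y, hy, rfl⟩ := F.lift x c hc hm
    exact ⟨y, hy, rfl⟩
  uniq h h' he := F.uniq h h'
    (hp.uniq _ _ _ (F.bang _) (F.bang _) (F.bang _) (F.le h) (F.le h') he)

end BoxFam

/-! ### Instantiation of graphs -/

open BoxFam

variable {I I' G G' H : Graph T Tag}

/-- The `!`-vertices of `I` whose boxes, transported to `G` along `i`, contain `x`. -/
def encl (i : Emb I G) (x : G.V) : Set I.V := {a | I.IsBang a ∧ x ∈ G.box (i.fV a)}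

/-- The `!`-vertices of `I` whose boxes contain an endpoint of the edge `a`. -/
def enclE (i : Emb I G) (a : G.E) : Set I.V := encl i (G.src a) ∪ encl i (G.tgt a)

theorem encl_up (hG : G.Nested) (i : Emb I G) {x : G.V} {a c : I.V} (ha : a ∈ encl i x)
    (hc : I.IsBang c) (h : a ∈ I.box c) : c ∈ encl i x :=
  ⟨hc, hG.nest _ _ (i.isBang_iff.2 hc) (i.isBang_iff.2 ha.1) ((i.mem_box hc).2 h) ha.2⟩

theorem enclE_up (hG : G.Nested) (i : Emb I G) {x : G.E} {a c : I.V} (ha : a ∈ enclE i x)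
    (hc : I.IsBang c) (h : a ∈ I.box c) : c ∈ enclE i x :=
  ha.imp (fun ha => encl_up hG i ha hc h) (fun ha => encl_up hG i ha hc h)

theorem encl_comp (f : Emb G H) (i : Emb I G) (x : G.V) :
    encl (f.comp i) (f.fV x) = encl i x := by
  ext a
  refine and_congr_right fun ha => ?_
  exact f.mem_box (i.isBang_iff.2 ha)

theorem enclE_comp (f : Emb G H) (i : Emb I G) (x : G.E) :
    enclE (f.comp i) (f.fE x) = enclE i x := by
  unfold enclE; rw [f.map_src, f.map_tgt, encl_comp, encl_comp]

/-- The concrete graph obtained from `G` by instantiating its `!`-boxes as the family `F` says: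
it has one copy of each vertex and edge for each compatible family of instantiations of the
`!`-boxes around it. -/
def inst (i : Emb I G) (F : BoxFam I) : Graph T Tag where
  V := {p : G.V × Set F.X // ¬ G.IsBang p.1 ∧ F.IsSec (encl i p.1) p.2}
  E := {p : G.E × Set F.X // G.IsPlain p.1 ∧ F.IsSec (enclE i p.1) p.2}
  finV := have := G.finV; have := F.fin; inferInstance
  finE := have := G.finE; have := F.fin; inferInstance
  src a := ⟨(G.src a.1.1, a.1.2 ∩ F.proj ⁻¹' encl i (G.src a.1.1)), a.2.1,
    a.2.2.restrict Set.subset_union_left⟩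
  tgt a := ⟨(G.tgt a.1.1, a.1.2 ∩ F.proj ⁻¹' encl i (G.tgt a.1.1)), a.2.1.tgt,
    a.2.2.restrict Set.subset_union_right⟩
  vty x := G.vty x.1.1
  ety a := G.ety a.1.1
  src_ty _ := G.src_ty _
  tgt_ty _ := G.tgt_ty _
  tag _ := none
  tag_bang _ h := (h rfl).elim

theorem inst_concrete (i : Emb I G) (F : BoxFam I) : (inst i F).Concrete := fun x => x.2.1

/-- The embedding of instantiated graphs induced by an embedding of graphs. -/
def instLeg (i : Emb I G) (F : BoxFam I) : Emb (inst (Emb.id I) F) (inst i F) where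
  fV x := ⟨(i.fV x.1.1, x.1.2), fun h => x.2.1 (i.isBang_iff.1 h), by
    have := x.2.2; rwa [← encl_comp i] at this⟩
  fE a := ⟨(i.fE a.1.1, a.1.2), fun h => a.2.1 (by
      rw [i.map_src] at h; exact i.isBang_iff.1 h), by
    have := a.2.2; rwa [← enclE_comp i] at this⟩
  map_src a := Subtype.ext (Prod.ext (i.map_src _) (by
    change a.1.2 ∩ F.proj ⁻¹' encl i (G.src (i.fE a.1.1)) = a.1.2 ∩ _
    rw [i.map_src]
    exact congrArg (fun U => a.1.2 ∩ F.proj ⁻¹' U) (encl_comp i (Emb.id I) _)))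
  map_tgt a := Subtype.ext (Prod.ext (i.map_tgt _) (by
    change a.1.2 ∩ F.proj ⁻¹' encl i (G.tgt (i.fE a.1.1)) = a.1.2 ∩ _
    rw [i.map_tgt]
    exact congrArg (fun U => a.1.2 ∩ F.proj ⁻¹' U) (encl_comp i (Emb.id I) _)))
  map_vty x := i.map_vty _
  map_ety a := i.map_ety _
  map_tag _ := rfl
  injV x y h := Subtype.ext (Prod.ext (i.injV (congrArg (fun z => z.1.1) h))
    (congrArg (fun z => z.1.2) h))
  injE x y h := Subtype.ext (Prod.ext (i.injE (congrArg (fun z => z.1.1) h))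
    (congrArg (fun z => z.1.2) h))
  reflects _ _ h _ := (inst_concrete _ _ _ h).elim

/-- The instantiation of a span. -/
def Span.inst (e : Span T Tag) (F : BoxFam e.I) : Span T Tag :=
  ⟨BangGraph.inst e.left F, BangGraph.inst (Emb.id e.I) F, BangGraph.inst e.right F,
    instLeg e.left F, instLeg e.right F⟩

theorem Span.inst_concrete (e : Span T Tag) (F : BoxFam e.I) : (e.inst F).Concrete :=
  ⟨BangGraph.inst_concrete _ _, BangGraph.inst_concrete _ _⟩

/-- Conditions on a graph homomorphism from `G'` to `G`, lying over a discrete fibration `p` from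
`I'` to `I`, under which instantiating `G'` by a family amounts to instantiating `G` by the pushed
forward family. -/
structure InstMap (i' : Emb I' G') (i : Emb I G) (F : BoxFam I') (p : I'.V → I.V)
    (hp : IsFibration p) where
  P : G'.V → G.V
  PE : G'.E → G.E
  src : ∀ a, G.src (PE a) = P (G'.src a)
  tgt : ∀ a, G.tgt (PE a) = P (G'.tgt a)
  vty : ∀ x, G.vty (P x) = G'.vty x
  ety : ∀ a, G.ety (PE a) = G'.ety a
  /- `κ` is a compatible family around `x` only if it is one around `P x`, and for each `κ` around a
  vertex of `G` there is exactly one vertex above it such that `κ` is a compatible family around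
  it. The same holds for edges. -/
  secV : ∀ x κ, F.IsSec (encl i' x) κ → (F.push p hp).IsSec (encl i (P x)) κ
  secE : ∀ a κ, F.IsSec (enclE i' a) κ → (F.push p hp).IsSec (enclE i (PE a)) κ
  restr_src : ∀ a κ, F.IsSec (enclE i' a) κ → ∀ z ∈ κ,
    (F.proj z ∈ encl i' (G'.src a) ↔ p (F.proj z) ∈ encl i (P (G'.src a)))
  restr_tgt : ∀ a κ, F.IsSec (enclE i' a) κ → ∀ z ∈ κ,
    (F.proj z ∈ encl i' (G'.tgt a) ↔ p (F.proj z) ∈ encl i (P (G'.tgt a)))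
  injV : ∀ x y κ, F.IsSec (encl i' x) κ → F.IsSec (encl i' y) κ → P x = P y → x = y
  injE : ∀ a c κ, F.IsSec (enclE i' a) κ → F.IsSec (enclE i' c) κ → PE a = PE c → a = c
  surjV : ∀ x (κ : Set F.X), (F.push p hp).IsSec (encl i x) κ →
    ∃ x', P x' = x ∧ F.IsSec (encl i' x') κ
  surjE : ∀ a (κ : Set F.X), (F.push p hp).IsSec (enclE i a) κ →
    ∃ a', PE a' = a ∧ F.IsSec (enclE i' a') κ

namespace InstMap

variable {i' : Emb I' G'} {i : Emb I G} {F : BoxFam I'} {p : I'.V → I.V} {hp : IsFibration p}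

theorem isBang_iff (M : InstMap i' i F p hp) {x : G'.V} : G.IsBang (M.P x) ↔ G'.IsBang x := by
  unfold Graph.IsBang; rw [M.vty]

/-- The induced map of instantiated graphs. -/
def emb (M : InstMap i' i F p hp) : Emb (inst i' F) (inst i (F.push p hp)) where
  fV x := ⟨(M.P x.1.1, x.1.2), fun h => x.2.1 (M.isBang_iff.1 h), M.secV _ _ x.2.2⟩
  fE a := ⟨(M.PE a.1.1, a.1.2), fun h => a.2.1 (by
    rw [M.src] at h; exact M.isBang_iff.1 h), M.secE _ _ a.2.2⟩
  map_src a := Subtype.ext (Prod.ext (M.src _) (by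
    change a.1.2 ∩ (F.push p hp).proj ⁻¹' encl i (G.src (M.PE a.1.1)) = a.1.2 ∩ _
    rw [M.src]
    ext z
    exact and_congr_right fun hz => (M.restr_src _ _ a.2.2 z hz).symm))
  map_tgt a := Subtype.ext (Prod.ext (M.tgt _) (by
    change a.1.2 ∩ (F.push p hp).proj ⁻¹' encl i (G.tgt (M.PE a.1.1)) = a.1.2 ∩ _
    rw [M.tgt]
    ext z
    exact and_congr_right fun hz => (M.restr_tgt _ _ a.2.2 z hz).symm))
  map_vty x := M.vty _
  map_ety x := M.ety _
  map_tag _ := rfl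
  injV x y h := by
    have h2 : x.1.2 = y.1.2 := congrArg (fun z => z.1.2) h
    exact Subtype.ext (Prod.ext (M.injV _ _ x.1.2 x.2.2 (h2 ▸ y.2.2)
      (congrArg (fun z => z.1.1) h)) h2)
  injE x y h := by
    have h2 : x.1.2 = y.1.2 := congrArg (fun z => z.1.2) h
    exact Subtype.ext (Prod.ext (M.injE _ _ x.1.2 x.2.2 (h2 ▸ y.2.2)
      (congrArg (fun z => z.1.1) h)) h2)
  reflects _ _ h _ := (inst_concrete _ _ _ h).elim

theorem isIso (M : InstMap i' i F p hp) : M.emb.IsIso := by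
  refine ⟨⟨M.emb.injV, ?_⟩, ⟨M.emb.injE, ?_⟩⟩
  · rintro ⟨⟨x, κ⟩, hx, hκ⟩
    obtain ⟨x', rfl, h'⟩ := M.surjV x κ hκ
    exact ⟨⟨(x', κ), fun h => hx (M.isBang_iff.2 h), h'⟩, rfl⟩
  · rintro ⟨⟨a, κ⟩, ha, hκ⟩
    obtain ⟨a', rfl, h'⟩ := M.surjE a κ hκ
    exact ⟨⟨(a', κ), fun h => ha (by rw [Graph.IsBang, M.src]; exact M.isBang_iff.2 h), h'⟩, rfl⟩

end InstMap

/-- Compatible maps on the three graphs of a span yield an isomorphism of instantiated spans. -/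
theorem Span.inst_iso_of_instMap {e' e : Span T Tag} {F : BoxFam e'.I} {p : e'.I.V → e.I.V}
    {hp : IsFibration p} (ML : InstMap e'.left e.left F p hp)
    (MI : InstMap (Emb.id e'.I) (Emb.id e.I) F p hp) (MR : InstMap e'.right e.right F p hp)
    (hlV : ∀ x, ML.P (e'.left.fV x) = e.left.fV (MI.P x))
    (hlE : ∀ x, ML.PE (e'.left.fE x) = e.left.fE (MI.PE x))
    (hrV : ∀ x, MR.P (e'.right.fV x) = e.right.fV (MI.P x))
    (hrE : ∀ x, MR.PE (e'.right.fE x) = e.right.fE (MI.PE x)) :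
    (e'.inst F).Iso (e.inst (F.push p hp)) :=
  ⟨ML.emb, MI.emb, MR.emb, ML.isIso, MI.isIso, MR.isIso,
    Emb.ext (funext fun x => Subtype.ext (Prod.ext (hlV x.1.1) rfl))
      (funext fun x => Subtype.ext (Prod.ext (hlE x.1.1) rfl)),
    Emb.ext (funext fun x => Subtype.ext (Prod.ext (hrV x.1.1) rfl))
      (funext fun x => Subtype.ext (Prod.ext (hrE x.1.1) rfl))⟩

/-! ### Pushing forward along embeddings -/

theorem Emb.isFibration (f : Emb I' I) : IsFibration f.fV where
  bang _ := f.isBang_iff.2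
  le _ _ _ hc := (f.mem_box hc).2
  lift _ _ _ hc h := f.exists_of_mem_box hc h
  uniq _ _ _ _ _ _ _ _ h := f.injV h

theorem BoxFam.isSec_push_emb (f : Emb I' I) (F : BoxFam I') {U' : Set I'.V} {U : Set I.V}
    (hU : ∀ a, a ∈ U' ↔ f.fV a ∈ U) (hr : U ⊆ Set.range f.fV) (κ : Set F.X) :
    F.IsSec U' κ ↔ (F.push f.fV f.isFibration).IsSec U κ := by
  constructor
  · intro h
    refine ⟨fun x hx => (hU _).1 (h.mem x hx), ?_, fun x hx y hy hxy => h.inj x hx y hy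
      (f.injV hxy), fun x hx y hy hyU => h.closed x hx y hy ((hU _).2 hyU)⟩
    intro a ha
    obtain ⟨a', rfl⟩ := hr ha
    obtain ⟨x, hx, rfl⟩ := h.ex a' ((hU _).2 ha)
    exact ⟨x, hx, rfl⟩
  · intro h
    refine ⟨fun x hx => (hU _).2 (h.mem x hx), ?_, fun x hx y hy hxy => h.inj x hx y hy
      (congrArg f.fV hxy), fun x hx y hy hyU => h.closed x hx y hy ((hU _).1 hyU)⟩
    intro a ha
    obtain ⟨x, hx, hxa⟩ := h.ex _ ((hU _).1 ha)
    exact ⟨x, hx, f.injV hxa⟩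

theorem mem_encl_emb {i' : Emb I' G'} {i : Emb I G} {f : Emb I' I} {g : Emb G' G}
    (h : g.comp i' = i.comp f) (x : G'.V) (a : I'.V) :
    a ∈ encl i' x ↔ f.fV a ∈ encl i (g.fV x) := by
  rw [← encl_comp g, h]
  exact and_congr_left fun _ => f.isBang_iff.symm

/-- Instantiating a subgraph is the same as instantiating the whole graph in such a way that the
`!`-boxes outside the subgraph are instantiated zero times, provided the subgraph is the part of
the graph which lies in no such `!`-box. -/
def instMapEmb {i' : Emb I' G'} {i : Emb I G} {f : Emb I' I} (g : Emb G' G)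
    (h : g.comp i' = i.comp f) (F : BoxFam I')
    (hg : ∀ c x, I.IsBang c → g.fV x ∈ G.box (i.fV c) → c ∈ Set.range f.fV)
    (hV : ∀ x, encl i x ⊆ Set.range f.fV → x ∈ Set.range g.fV)
    (hE : ∀ a, G.src a ∈ Set.range g.fV → G.tgt a ∈ Set.range g.fV → a ∈ Set.range g.fE) :
    InstMap i' i F f.fV f.isFibration :=
  have hsec : ∀ x κ, F.IsSec (encl i' x) κ ↔
      (F.push f.fV f.isFibration).IsSec (encl i (g.fV x)) κ := fun x =>
    F.isSec_push_emb f (mem_encl_emb h x) fun c hc => hg c x hc.1 hc.2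
  have hsecE : ∀ a κ, F.IsSec (enclE i' a) κ ↔
      (F.push f.fV f.isFibration).IsSec (enclE i (g.fE a)) κ := fun a =>
    F.isSec_push_emb f (fun c => by
      unfold enclE
      rw [g.map_src, g.map_tgt]
      exact or_congr (mem_encl_emb h _ c) (mem_encl_emb h _ c)) fun c hc => by
      unfold enclE at hc
      rw [g.map_src, g.map_tgt] at hc
      exact hc.elim (fun hc => hg c _ hc.1 hc.2) (fun hc => hg c _ hc.1 hc.2)
  have hran : ∀ {U κ}, (F.push f.fV f.isFibration).IsSec U κ → U ⊆ Set.range f.fV := by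
    intro U κ hκ a ha
    obtain ⟨x, -, rfl⟩ := hκ.ex a ha
    exact ⟨F.proj x, rfl⟩
  { P := g.fV
    PE := g.fE
    src := g.map_src
    tgt := g.map_tgt
    vty := g.map_vty
    ety := g.map_ety
    secV := fun x κ => (hsec x κ).1
    secE := fun a κ => (hsecE a κ).1
    restr_src := fun _ _ _ z _ => mem_encl_emb h _ (F.proj z)
    restr_tgt := fun _ _ _ z _ => mem_encl_emb h _ (F.proj z)
    injV := fun _ _ _ _ _ h => g.injV h
    injE := fun _ _ _ _ _ h => g.injE h
    surjV := fun x κ hκ => by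
      obtain ⟨x', rfl⟩ := hV x (hran hκ)
      exact ⟨x', rfl, (hsec x' κ).2 hκ⟩
    surjE := fun a κ hκ => by
      obtain ⟨a', rfl⟩ := hE a (hV _ (Set.subset_union_left.trans (hran hκ)))
        (hV _ (Set.subset_union_right.trans (hran hκ)))
      exact ⟨a', rfl, (hsecE a' κ).2 hκ⟩ }

/-- An isomorphism of spans induces one of instantiations. -/
theorem Span.Iso.inst {e' e : Span T Tag} (l : Emb e'.L e.L) (m : Emb e'.I e.I) (r : Emb e'.R e.R)
    (hl : l.IsIso) (hm : m.IsIso) (hr : r.IsIso) (h1 : l.comp e'.left = e.left.comp m)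
    (h2 : r.comp e'.right = e.right.comp m) (F : BoxFam e'.I) :
    (e'.inst F).Iso (e.inst (F.push m.fV m.isFibration)) :=
  inst_iso_of_instMap
    (instMapEmb l h1 F (fun _ _ _ _ => hm.1.2 _) (fun _ _ => hl.1.2 _) (fun _ _ _ => hl.2.2 _))
    (instMapEmb (i' := Emb.id _) (i := Emb.id _) (f := m) m rfl F (fun _ _ _ _ => hm.1.2 _)
      (fun _ _ => hm.1.2 _) (fun _ _ _ => hm.2.2 _))
    (instMapEmb r h2 F (fun _ _ _ _ => hm.1.2 _) (fun _ _ => hr.1.2 _) (fun _ _ _ => hr.2.2 _))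
    (fun x => congrArg (fun k => k.fV x) h1) (fun x => congrArg (fun k => k.fE x) h1)
    (fun x => congrArg (fun k => k.fV x) h2) (fun x => congrArg (fun k => k.fE x) h2)

/-! ### Instantiation of `KILL_b` -/

/-- The embedding of `KILL_b`. It reflects `!`-box containment since the vertices of `B(b)` contain
no vertices outside `B(b)`. -/
def killEmb (hG : G.Nested) (b : G.Bang) : Emb (G.kill b) G where
  fV := Subtype.val
  fE := Subtype.val
  map_src _ := rfl
  map_tgt _ := rfl
  map_vty _ := rfl
  map_ety _ := rfl
  map_tag _ := rfl
  injV := Subtype.val_injective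
  injE := Subtype.val_injective
  reflects a x hs ht := by
    refine ⟨⟨a, fun h => x.2 ?_, ht ▸ x.2⟩, rfl⟩
    exact hG.nest _ _ b.2 hs h (Or.inr ⟨a, rfl, ht⟩)

/-- A span in which the laws of `!`-box containment hold and both sides have the same
`!`-vertices. -/
structure Span.Good (e : Span T Tag) : Prop where
  L : e.L.Nested
  I : e.I.Nested
  R : e.R.Nested
  coverL : ∀ x, e.L.IsBang x → ∃ y, e.left.fV y = x
  coverR : ∀ x, e.R.IsBang x → ∃ y, e.right.fV y = x

theorem Span.IsEquation.good {e : Span T Tag} (h : e.IsEquation) : e.Good where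
  L := h.bangL.nested
  I := h.bangI.nested
  R := h.bangR.nested
  coverL x hx := (h.boundL.1 x).2 (Or.inl hx)
  coverR x hx := (h.boundR.1 x).2 (Or.inl hx)

theorem notMem_box_of_encl (hG : G.Nested) {i : Emb I G} {b c : I.V} (hb : I.IsBang b)
    {x : G.V} (hx : x ∉ G.box (i.fV b)) (hc : c ∈ encl i x) : c ∉ I.box b :=
  fun h => hx (encl_up hG i hc hb h).2

/-- Instantiating `KILL_b` is instantiating `b` zero times. -/
def instMapKill (hI : I.Nested) (hG : G.Nested) (i : Emb I G) (b : I.Bang)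
    (i' : Emb (I.kill b) (G.kill (i.bang b)))
    (h : (killEmb hG (i.bang b)).comp i' = i.comp (killEmb hI b)) (F : BoxFam (I.kill b)) :
    InstMap i' i F (killEmb hI b).fV (killEmb hI b).isFibration :=
  instMapEmb (killEmb hG (i.bang b)) h F
    (fun c x hc hx => ⟨⟨c, notMem_box_of_encl hG b.2 x.2 ⟨hc, hx⟩⟩, rfl⟩)
    (fun x hx => ⟨⟨x, fun hxb => by
      obtain ⟨c, hc⟩ := hx ⟨b.2, hxb⟩
      exact c.2 (Or.inl hc)⟩, rfl⟩)
    (by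
      rintro a ⟨x, hx⟩ ⟨y, hy⟩
      exact ⟨⟨a, hx ▸ x.2, hy ▸ y.2⟩, rfl⟩)

/-- The family on `KILL_b` given by a family that has no elements over `b`. -/
def BoxFam.pullKill (hI : I.Nested) (F : BoxFam I) (b : I.Bang) (h : F.fib b.1 = ∅) :
    BoxFam (I.kill b) where
  X := F.X
  fin := F.fin
  proj x := ⟨F.proj x, fun hx => by
    obtain ⟨y, -, hy⟩ := F.lift x b.1 b.2 hx
    exact (h ▸ hy : y ∈ (∅ : Set F.X))⟩
  rel := F.rel
  bang := F.bang
  rel_refl := F.rel_refl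
  rel_trans := F.rel_trans
  le {x y} h := (Graph.mem_box_del _ _).2 (F.le h)
  lift x a ha hx := by
    obtain ⟨y, hy, hya⟩ := F.lift x a.1 ha (((killEmb hI b).mem_box ha).2 hx)
    exact ⟨y, hy, Subtype.ext hya⟩
  uniq h h' he := F.uniq h h' (congrArg Subtype.val he)

namespace Span

variable {e : Span T Tag}

theorem Good.kill (h : e.Good) (b : e.I.Bang) : (e.kill b).Good where
  L := h.L.del _
  I := h.I.del _
  R := h.R.del _
  coverL x hx := by
    obtain ⟨y, hy⟩ := h.coverL x.1 hx
    exact ⟨⟨y, fun hyb => x.2 (hy ▸ (e.left.mem_box b.2).2 hyb)⟩, Subtype.ext hy⟩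
  coverR x hx := by
    obtain ⟨y, hy⟩ := h.coverR x.1 hx
    exact ⟨⟨y, fun hyb => x.2 (hy ▸ (e.right.mem_box b.2).2 hyb)⟩, Subtype.ext hy⟩

/-- `KillRel b F F'`: instantiating `KILL_b(e)` by `F'` amounts to instantiating `e` by `F`. -/
structure KillRel (e : Span T Tag) (b : e.I.Bang) (F : BoxFam e.I) (F' : BoxFam (e.kill b).I) :
    Prop where
  iso : ((e.kill b).inst F').Iso (e.inst F)
  fib : F.fib b.1 = ∅
  fib_eq : ∀ c (hc : c ∉ e.I.box b.1), (F.fib c).ncard = (F'.fib ⟨c, hc⟩).ncard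
  card : Nat.card F'.X = Nat.card F.X

theorem Good.killRel_push (h : e.Good) (b : e.I.Bang) (F' : BoxFam (e.kill b).I) :
    e.KillRel b (F'.push _ (killEmb h.I b).isFibration) F' where
  iso := inst_iso_of_instMap (instMapKill h.I h.L e.left b (e.kill b).left rfl F')
      (instMapKill h.I h.I (Emb.id e.I) b (Emb.id _) rfl F')
      (instMapKill h.I h.R e.right b (e.kill b).right rfl F')
      (fun _ => rfl) (fun _ => rfl) (fun _ => rfl) (fun _ => rfl)
  fib := by
    ext x
    exact iff_of_false (fun hx => (F'.proj x).2 (Or.inl hx)) (fun h => h)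
  fib_eq c hc := by
    congr 1
    ext x
    exact (Subtype.ext_iff (a1 := F'.proj x) (a2 := ⟨c, hc⟩)).symm
  card := rfl

theorem Good.exists_killRel_pull (h : e.Good) (b : e.I.Bang) (F : BoxFam e.I)
    (hF : F.fib b.1 = ∅) : ∃ F', e.KillRel b F F' :=
  ⟨F.pullKill h.I b hF, h.killRel_push b (F.pullKill h.I b hF)⟩

end Span

/-! ### Instantiation of `COPY_b` -/

theorem isFibration_base (hI : I.Nested) (b : I.Bang) :
    IsFibration (I' := I.copy b) (I := I) (Graph.base (b := b)) where
  bang _ := Graph.isBang_base.2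
  le a c _ hc h := ((Graph.mem_box_copy hI hc).1 h).1
  lift a c ha hc h := by
    obtain ⟨c', rfl, hc'⟩ := Graph.exists_copy_vertex (b := b) c (Sum.isRight a)
    have hc2 := Graph.isBang_base.1 hc
    exact ⟨c', hc2, rfl, (Graph.mem_box_copy hI hc2).2 ⟨h, fun h2 => (hc' h2).symm⟩⟩
  uniq a c d ha hc hd hac had h := by
    have h1 := (Graph.mem_box_copy hI hc).1 hac
    have h2 := (Graph.mem_box_copy hI hd).1 had
    exact Graph.copy_ext h fun h3 => (h1.2 h3).symm.trans (h2.2 (h ▸ h3))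

/-- The family on `I` induced by a family on `COPY_b`. -/
noncomputable abbrev BoxFam.pushCopy (hI : I.Nested) (b : I.Bang) (F : BoxFam (I.copy b)) :
    BoxFam I :=
  F.push _ (isFibration_base hI b)

/-- The vertices of `I.copy b` over a set `U`, where those that are not shared by the two copies
of `I` are to be in the copy singled out by `s`. -/
noncomputable def sideSet (b : I.Bang) (U : Set I.V) (s : Bool) : Set (I.copy b).V :=
  {a | Graph.base (b := b) a ∈ U ∧
    (Graph.base (b := b) a ∈ I.box b.1 → Sum.isRight a = s)}

/-- A compatible family on `COPY_b` around a vertex or an edge is one on `I` that takes place in the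
right copy of `B(b)`. -/
theorem isSec_sideSet (hI : I.Nested) (b : I.Bang) (F : BoxFam (I.copy b)) {U : Set I.V}
    {s : Bool} {κ : Set F.X} :
    F.IsSec (sideSet b U s) κ ↔ (F.pushCopy hI b).IsSec U κ ∧
      ∀ x ∈ κ, Graph.base (F.proj x) ∈ I.box b.1 → Sum.isRight (F.proj x) = s := by
  constructor
  · intro h
    refine ⟨⟨fun x hx => (h.mem x hx).1, ?_, ?_, ?_⟩, fun x hx => (h.mem x hx).2⟩
    · intro a ha
      obtain ⟨a', rfl, ha'⟩ := Graph.exists_copy_vertex (b := b) a s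
      obtain ⟨x, hx, rfl⟩ := h.ex a' ⟨ha, ha'⟩
      exact ⟨x, hx, rfl⟩
    · intro x hx y hy hxy
      have hxy : Graph.base (F.proj x) = Graph.base (F.proj y) := hxy
      exact h.inj x hx y hy (Graph.copy_ext hxy fun hb =>
        ((h.mem x hx).2 hb).trans ((h.mem y hy).2 (hxy ▸ hb)).symm)
    · intro x hx y hyx hyU
      refine h.closed x hx y hyx ⟨hyU, fun hyb => ?_⟩
      have h1 := (Graph.mem_box_copy hI (F.bang y)).1 (F.le hyx)
      rw [← h1.2 hyb]
      exact (h.mem x hx).2 (hI.nest b.1 _ b.2 (Graph.isBang_base.2 (F.bang y)) hyb h1.1)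
  · rintro ⟨h, hs⟩
    refine ⟨fun x hx => ⟨h.mem x hx, hs x hx⟩, ?_, ?_, ?_⟩
    · intro a ha
      obtain ⟨x, hx, hxa⟩ := h.ex _ ha.1
      exact ⟨x, hx, Graph.copy_ext hxa fun hb => (hs x hx hb).trans (ha.2 (hxa ▸ hb)).symm⟩
    · exact fun x hx y hy hxy => h.inj x hx y hy (congrArg Graph.base hxy)
    · exact fun x hx y hyx hyU => h.closed x hx y hyx hyU.1

/-- A compatible family of instantiations whose boxes include `b` takes place in one of the two
copies of `B(b)`. -/
theorem exists_side (hI : I.Nested) (b : I.Bang) (F : BoxFam (I.copy b)) {U : Set I.V}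
    {κ : Set F.X} (h : (F.pushCopy hI b).IsSec U κ) (hU : ∀ a ∈ U, a ∈ I.box b.1 → b.1 ∈ U) :
    ∃ s : Bool, ∀ x ∈ κ, Graph.base (F.proj x) ∈ I.box b.1 → Sum.isRight (F.proj x) = s := by
  by_cases hb : b.1 ∈ U
  · obtain ⟨z, hz, hzb⟩ := h.ex _ hb
    refine ⟨Sum.isRight (F.proj z), fun x hx hxb => ?_⟩
    obtain ⟨y, hyx, hyb⟩ := (F.pushCopy hI b).lift x b.1 b.2 hxb
    have hyz : y = z := h.inj y (h.closed x hx y hyx (hyb ▸ hb)) z hz (hyb.trans hzb.symm)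
    subst hyz
    refine ((Graph.mem_box_copy hI (F.bang y)).1 (F.le hyx)).2 ?_
    exact Or.inl hyb
  · exact ⟨true, fun x hx hxb => (hb (hU _ (h.mem x hx) hxb)).elim⟩

section Copy

variable (hI : I.Nested) (hG : G.Nested) (i : Emb I G) (b : I.Bang)
  (i' : Emb (I.copy b) (G.copy (i.bang b))) (h : ∀ y, i'.fV y = (i.copy b).fV y)

include hG h

theorem encl_copy (x : (G.copy (i.bang b)).V) :
    encl i' x = sideSet b (encl i (Graph.base x)) (Sum.isRight x) := by
  ext a
  have hbase : Graph.base (i'.fV a) = i.fV (Graph.base (b := b) a) := by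
    rw [h]; rcases a with a | a <;> rfl
  have hside : Sum.isRight (i'.fV a) = Sum.isRight a := by
    rw [h]; rcases a with a | a <;> rfl
  constructor
  · rintro ⟨ha, hx⟩
    have hx := (Graph.mem_box_copy hG (i'.isBang_iff.2 ha)).1 hx
    rw [hbase, hside] at hx
    exact ⟨⟨Graph.isBang_base.2 ha, hx.1⟩, fun hb => (hx.2 ((i.mem_box b.2).2 hb)).symm⟩
  · rintro ⟨ha, hx⟩
    have ha' := Graph.isBang_base.1 ha.1
    refine ⟨ha', (Graph.mem_box_copy hG (i'.isBang_iff.2 ha')).2 ?_⟩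
    rw [hbase, hside]
    exact ⟨ha.2, fun hb => (hx ((i.mem_box b.2).1 hb)).symm⟩

theorem encl_copy_of (x : (G.copy (i.bang b)).V) (s : Bool)
    (hs : Graph.base x ∈ G.box (i.bang b).1 → Sum.isRight x = s) :
    encl i' x = sideSet b (encl i (Graph.base x)) s := by
  rw [encl_copy hG i b i' h]
  by_cases hx : Graph.base x ∈ G.box (i.bang b).1
  · rw [hs hx]
  · ext a
    refine and_congr_right fun ha => ?_
    have := notMem_box_of_encl hG b.2 hx ha
    exact ⟨fun _ hc => (this hc).elim, fun _ hc => (this hc).elim⟩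

theorem encl_copy_src (a : (G.copy (i.bang b)).E) :
    encl i' ((G.copy (i.bang b)).src a) =
      sideSet b (encl i (G.src (Graph.baseE a))) (Sum.isRight a) := by
  rw [← Graph.base_src]
  exact encl_copy_of hG i b i' h _ _ fun hx => Graph.isRight_src a (Graph.base_src a ▸ hx)

theorem encl_copy_tgt (a : (G.copy (i.bang b)).E) :
    encl i' ((G.copy (i.bang b)).tgt a) =
      sideSet b (encl i (G.tgt (Graph.baseE a))) (Sum.isRight a) := by
  rw [← Graph.base_tgt]
  exact encl_copy_of hG i b i' h _ _ fun hx => Graph.isRight_tgt a (Graph.base_tgt a ▸ hx)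

theorem enclE_copy (a : (G.copy (i.bang b)).E) :
    enclE i' a = sideSet b (enclE i (Graph.baseE a)) (Sum.isRight a) := by
  rw [enclE, encl_copy_src hG i b i' h, encl_copy_tgt hG i b i' h]
  ext c
  exact or_and_right.symm

/-- Instantiating `COPY_b` is instantiating `b` as often as both of its copies taken together. -/
noncomputable def instMapCopy (F : BoxFam (I.copy b)) :
    InstMap i' i F _ (isFibration_base hI b) where
  P := Graph.base
  PE := Graph.baseE
  src a := (Graph.base_src a).symm
  tgt a := (Graph.base_tgt a).symm
  vty := Graph.vty_base
  ety := by rintro (a | a) <;> rfl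
  secV x κ hκ := by
    rw [encl_copy hG i b i' h, isSec_sideSet hI] at hκ
    exact hκ.1
  secE a κ hκ := by
    rw [enclE_copy hG i b i' h, isSec_sideSet hI] at hκ
    exact hκ.1
  restr_src a κ hκ z hz := by
    rw [enclE_copy hG i b i' h, isSec_sideSet hI] at hκ
    rw [encl_copy_src hG i b i' h, Graph.base_src]
    exact and_iff_left (hκ.2 z hz)
  restr_tgt a κ hκ z hz := by
    rw [enclE_copy hG i b i' h, isSec_sideSet hI] at hκ
    rw [encl_copy_tgt hG i b i' h, Graph.base_tgt]
    exact and_iff_left (hκ.2 z hz)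
  injV x y κ hx hy hxy := by
    rw [encl_copy hG i b i' h, isSec_sideSet hI] at hx hy
    refine Graph.copy_ext hxy fun hb => ?_
    obtain ⟨z, hz, hzb⟩ := hx.1.ex b.1 ⟨b.2, hb⟩
    have hzb' : Graph.base (F.proj z) ∈ I.box b.1 := Or.inl hzb
    exact (hx.2 z hz hzb').symm.trans (hy.2 z hz hzb')
  injE x y κ hx hy hxy := by
    rw [enclE_copy hG i b i' h, isSec_sideSet hI] at hx hy
    refine Graph.copyE_ext hxy fun hb => ?_
    obtain ⟨z, hz, hzb⟩ := hx.1.ex b.1 (hb.imp (fun hb => ⟨b.2, hb⟩) (fun hb => ⟨b.2, hb⟩))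
    have hzb' : Graph.base (F.proj z) ∈ I.box b.1 := Or.inl hzb
    exact (hx.2 z hz hzb').symm.trans (hy.2 z hz hzb')
  surjV x κ hκ := by
    obtain ⟨s, hs⟩ := exists_side hI b F hκ fun a ha hab => encl_up hG i ha b.2 hab
    obtain ⟨x', rfl, hx'⟩ := Graph.exists_copy_vertex (b := i.bang b) x s
    refine ⟨x', rfl, ?_⟩
    rw [encl_copy_of hG i b i' h x' s hx']
    exact (isSec_sideSet hI b F).2 ⟨hκ, hs⟩
  surjE a κ hκ := by
    obtain ⟨s, hs⟩ := exists_side hI b F hκ fun a ha hab => enclE_up hG i ha b.2 hab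
    obtain ⟨a', rfl, ha'⟩ := Graph.exists_copy_edge (b := i.bang b) a s
    refine ⟨a', rfl, ?_⟩
    rw [enclE_copy hG i b i' h]
    refine (isSec_sideSet hI b F).2 ⟨hκ, fun z hz hzb => ?_⟩
    rw [hs z hz hzb]
    refine (ha' ?_).symm
    have hbU := enclE_up hG i (hκ.mem z hz) b.2 hzb
    exact hbU.imp And.right And.right

end Copy

/-! ### Families on `COPY_b` -/

namespace BoxFam

open Classical in
/-- A lift of the projection of `F` to `COPY_b`, given by a set `Q` of elements over `b`: the
instantiations that take place inside an element of `Q` are attributed to the second copy of `B(b)`,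
the other ones to the first copy. -/
noncomputable def pullProj (F : BoxFam I) (b : I.Bang) (Q : Set F.X) (x : F.X) : (I.copy b).V :=
  if h : ∃ y ∈ Q, F.rel y x ∧ F.proj y = b.1 then
    .inr ⟨F.proj x, by obtain ⟨y, -, hy, hb⟩ := h; exact hb ▸ F.le hy⟩
  else .inl (F.proj x)

theorem pullProj_pos {F : BoxFam I} {b : I.Bang} {Q : Set F.X} {x : F.X}
    (h : ∃ y ∈ Q, F.rel y x ∧ F.proj y = b.1) :
    ∃ hx, F.pullProj b Q x = Sum.inr ⟨F.proj x, hx⟩ := ⟨_, dif_pos h⟩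

theorem pullProj_neg {F : BoxFam I} {b : I.Bang} {Q : Set F.X} {x : F.X}
    (h : ¬ ∃ y ∈ Q, F.rel y x ∧ F.proj y = b.1) :
    F.pullProj b Q x = Sum.inl (F.proj x) := dif_neg h

theorem base_pullProj (F : BoxFam I) (b : I.Bang) (Q : Set F.X) (x : F.X) :
    Graph.base (F.pullProj b Q x) = F.proj x := by
  by_cases h : ∃ y ∈ Q, F.rel y x ∧ F.proj y = b.1
  · obtain ⟨_, h⟩ := pullProj_pos h
    exact congrArg Graph.base h
  · exact congrArg Graph.base (pullProj_neg h)

theorem isRight_pullProj (F : BoxFam I) (b : I.Bang) (Q : Set F.X) (x : F.X) :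
    Sum.isRight (F.pullProj b Q x) = true ↔ ∃ y ∈ Q, F.rel y x ∧ F.proj y = b.1 := by
  by_cases h : ∃ y ∈ Q, F.rel y x ∧ F.proj y = b.1
  · obtain ⟨_, h'⟩ := pullProj_pos h
    exact iff_of_true (congrArg Sum.isRight h') h
  · exact iff_of_false
      (fun h' => Bool.noConfusion ((congrArg Sum.isRight (pullProj_neg h)).symm.trans h')) h

theorem isRight_pullProj_eq (F : BoxFam I) (b : I.Bang) (Q : Set F.X) {x y : F.X}
    (h : F.rel y x) (hy : F.proj y ∈ I.box b.1) :
    Sum.isRight (F.pullProj b Q x) = Sum.isRight (F.pullProj b Q y) := by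
  rw [Bool.eq_iff_iff, isRight_pullProj, isRight_pullProj]
  constructor
  · rintro ⟨w, hw, hwx, hwb⟩
    obtain ⟨w', hw', hwb'⟩ := F.lift y b.1 b.2 hy
    obtain rfl := F.uniq hwx (F.rel_trans hw' h) (hwb.trans hwb'.symm)
    exact ⟨w, hw, hw', hwb⟩
  · rintro ⟨w, hw, hwy, hwb⟩
    exact ⟨w, hw, F.rel_trans hwy h, hwb⟩

theorem isBang_pullProj (F : BoxFam I) (b : I.Bang) (Q : Set F.X) (x : F.X) :
    (I.copy b).IsBang (F.pullProj b Q x) := by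
  rw [← Graph.isBang_base, base_pullProj]; exact F.bang x

/-- The family on `COPY_b` with `pullProj` as its projection. -/
noncomputable def pullCopy (hI : I.Nested) (F : BoxFam I) (b : I.Bang) (Q : Set F.X) :
    BoxFam (I.copy b) where
  X := F.X
  fin := F.fin
  proj := F.pullProj b Q
  rel := F.rel
  bang := F.isBang_pullProj b Q
  rel_refl := F.rel_refl
  rel_trans := F.rel_trans
  le {x y} h := by
    rw [Graph.mem_box_copy hI (F.isBang_pullProj b Q y), base_pullProj, base_pullProj]
    exact ⟨F.le h, F.isRight_pullProj_eq b Q h⟩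
  lift x a ha hx := by
    rw [Graph.mem_box_copy hI ha, base_pullProj] at hx
    obtain ⟨y, hy, hya⟩ := F.lift x _ (Graph.isBang_base.2 ha) hx.1
    refine ⟨y, hy, Graph.copy_ext ((F.base_pullProj b Q y).trans hya) fun h => ?_⟩
    rw [base_pullProj] at h
    rw [← F.isRight_pullProj_eq b Q hy h, hx.2 (hya ▸ h)]
  uniq {x y y'} h h' he := F.uniq h h' (by
    rw [← F.base_pullProj b Q y, he, base_pullProj])

theorem eq_of_proj_eq (F : BoxFam I) {proj : F.X → I.V} (h : proj = F.proj) (h₁ h₂ h₃ h₄) :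
    (⟨F.X, F.fin, proj, F.rel, h₁, F.rel_refl, F.rel_trans, h₂, h₃, h₄⟩ : BoxFam I) = F := by
  subst h; rfl

theorem pushCopy_pullCopy (hI : I.Nested) (F : BoxFam I) (b : I.Bang) (Q : Set F.X) :
    (F.pullCopy hI b Q).pushCopy hI b = F :=
  F.eq_of_proj_eq (funext (F.base_pullProj b Q)) _ _ _ _

/-! ### Instantiation of `DROP_b` -/

/-- The `!`-vertices whose boxes contain a dropped `!`-vertex `b`. -/
abbrev above (b : I.Bang) : Set (I.drop b).V := {a | (I.drop b).IsBang a ∧ b.1 ∈ I.box a.1}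

/-- `DropRel b F F' q` expresses that `F` is the family by which one has to instantiate `I` in
order to get the same as by instantiating `DROP_b(I)` by `F'`: it is `F'`, embedded by `q`,
together with one instantiation of `b` in each compatible family of instantiations of the
`!`-boxes around `b`. -/
structure DropRel (b : I.Bang) (F : BoxFam I) (F' : BoxFam (I.drop b)) (q : F'.X → F.X) :
    Prop where
  inj : Function.Injective q
  proj : ∀ x, F.proj (q x) = (F'.proj x).1
  range : ∀ x, F.proj x ≠ b.1 → x ∈ Set.range q
  rel : ∀ x y, F.rel (q y) (q x) ↔ F'.rel y x
  ex : ∀ κ, F'.IsSec (above b) κ →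
    ∃ z, F.proj z = b.1 ∧ ∀ y, F.rel (q y) z ↔ y ∈ κ
  ext : ∀ z z', F.proj z = b.1 → F.proj z' = b.1 →
    (∀ y, F.rel (q y) z ↔ F.rel (q y) z') → z = z'

namespace DropRel

variable {b : I.Bang} {F : BoxFam I} {F' : BoxFam (I.drop b)} {q : F'.X → F.X}

theorem exists_or (h : DropRel b F F' q) (x : F.X) : (∃ y, q y = x) ∨ F.proj x = b.1 := by
  by_cases hx : F.proj x = b.1
  · exact Or.inr hx
  · exact Or.inl (h.range x hx)

theorem proj_ne (h : DropRel b F F' q) (y : F'.X) : F.proj (q y) ≠ b.1 := by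
  rw [h.proj]; exact fun hy => (F'.proj y).2 hy

/-- Compatible families for `F` are determined by their parts in `F'`, and each compatible family
for `F'` arises in this way; see `eq_of_preimage_eq` and `exists_preimage_eq`. -/
theorem isSec_preimage (h : DropRel b F F' q) {U : Set I.V} {κ : Set F.X} (hκ : F.IsSec U κ) :
    F'.IsSec (Subtype.val ⁻¹' U) (q ⁻¹' κ) where
  mem x hx := by
    have := hκ.mem _ hx
    rwa [h.proj] at this
  ex a ha := by
    obtain ⟨x, hx, hxa⟩ := hκ.ex _ ha
    obtain ⟨y, rfl⟩ := h.range x (fun hx' => a.2 (hxa.symm.trans hx'))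
    exact ⟨y, hx, Subtype.ext ((h.proj y).symm.trans hxa)⟩
  inj x hx y hy hxy := h.inj (hκ.inj _ hx _ hy (by rw [h.proj, h.proj, hxy]))
  closed x hx y hyx hyU := hκ.closed _ hx _ ((h.rel x y).2 hyx) (by rw [h.proj]; exact hyU)

theorem eq_of_preimage_eq (h : DropRel b F F' q) {U : Set I.V}
    (hU : ∀ a c, a ∈ U → I.IsBang c → a ∈ I.box c → c ∈ U) {κ κ' : Set F.X}
    (hκ : F.IsSec U κ) (hκ' : F.IsSec U κ') (he : q ⁻¹' κ = q ⁻¹' κ') : κ = κ' := by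
  suffices key : ∀ {κ κ' : Set F.X}, F.IsSec U κ → F.IsSec U κ' → q ⁻¹' κ = q ⁻¹' κ' →
      κ ⊆ κ' from (key hκ hκ' he).antisymm (key hκ' hκ he.symm)
  intro κ κ' hκ hκ' he z hz
  have hqq : ∀ y, q y ∈ κ ↔ q y ∈ κ' := fun y => Set.ext_iff.1 he y
  have aux : ∀ {κ κ' : Set F.X} {z z' : F.X}, F.IsSec U κ → F.IsSec U κ' →
      (∀ y, q y ∈ κ → q y ∈ κ') → z ∈ κ → z' ∈ κ' → F.proj z = b.1 → F.proj z' = b.1 →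
      ∀ y, F.rel (q y) z → F.rel (q y) z' := by
    intro κ κ' z z' hκ hκ' hqq hz hz' hzb hzb' y hy
    have hyU := hU _ _ (hκ.mem z hz) (F.bang (q y)) (F.le hy)
    have hle := F.le hy
    rw [hzb, ← hzb'] at hle
    obtain ⟨w, hw, hwy⟩ := F.lift z' _ (F.bang (q y)) hle
    have := hκ'.inj w (hκ'.closed z' hz' w hw (hwy ▸ hyU)) (q y)
      (hqq y (hκ.closed z hz _ hy hyU)) hwy
    exact this ▸ hw
  rcases h.exists_or z with ⟨y, rfl⟩ | hzb
  · exact (hqq y).1 hz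
  · obtain ⟨z', hz', hzz'⟩ := hκ'.ex _ (hκ.mem z hz)
    have hzb' := hzz'.trans hzb
    rw [h.ext z z' hzb hzb' fun y =>
      ⟨aux hκ hκ' (fun y => (hqq y).1) hz hz' hzb hzb' y,
        aux hκ' hκ (fun y => (hqq y).2) hz' hz hzb' hzb y⟩]
    exact hz'

theorem exists_preimage_eq (h : DropRel b F F' q) {U : Set I.V}
    (hU : ∀ a c, a ∈ U → I.IsBang c → a ∈ I.box c → c ∈ U) {κ' : Set F'.X}
    (hκ : F'.IsSec (Subtype.val ⁻¹' U) κ') : ∃ κ, F.IsSec U κ ∧ q ⁻¹' κ = κ' := by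
  by_cases hb : b.1 ∈ U
  · -- the members of `κ'` around `b` determine the instantiation `z` of `b` that is to be added
    have hsub : above b ⊆ Subtype.val ⁻¹' U := fun a ha => hU _ _ hb ha.1 ha.2
    obtain ⟨z, hzb, hz⟩ := h.ex _ (hκ.restrict hsub)
    have hqz : ∀ y, q y ≠ z := fun y hy => h.proj_ne y (hy ▸ hzb)
    refine ⟨q '' κ' ∪ {z}, ⟨?_, ?_, ?_, ?_⟩, ?_⟩
    · rintro x (⟨y, hy, rfl⟩ | rfl)
      · rw [h.proj]; exact hκ.mem y hy
      · rw [hzb]; exact hb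
    · intro a ha
      by_cases hab : a = b.1
      · exact ⟨z, Or.inr rfl, hzb.trans hab.symm⟩
      · obtain ⟨y, hy, hya⟩ := hκ.ex ⟨a, hab⟩ ha
        exact ⟨q y, Or.inl ⟨y, hy, rfl⟩, (h.proj y).trans (congrArg Subtype.val hya)⟩
    · rintro x (⟨y, hy, rfl⟩ | rfl) x' (⟨y', hy', rfl⟩ | rfl) hxy
      · rw [h.proj, h.proj] at hxy
        rw [hκ.inj y hy y' hy' (Subtype.ext hxy)]
      · exact (h.proj_ne y (hxy.trans hzb)).elim
      · exact (h.proj_ne y' (hxy.symm.trans hzb)).elim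
      · rfl
    · rintro x (⟨y, hy, rfl⟩ | rfl) x' hx' hxU
      · rcases h.exists_or x' with ⟨y', rfl⟩ | hxb
        · refine Or.inl ⟨y', hκ.closed y hy y' ((h.rel _ _).1 hx') ?_, rfl⟩
          rw [h.proj] at hxU; exact hxU
        · -- `x'` and `z` agree because `x'` takes place inside the same members of `κ'` as `z`
          refine Or.inr (h.ext _ _ hxb hzb fun w => ?_)
          rw [hz]
          constructor
          · intro hw
            have hle := F.le hw
            rw [hxb, h.proj] at hle
            have hbw : (I.drop b).IsBang (F'.proj w) := F'.bang w
            exact ⟨hκ.closed y hy w ((h.rel _ _).1 (F.rel_trans hw hx')) (hU _ _ hb hbw hle),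
              hbw, hle⟩
          · rintro ⟨hw, hbw, hle⟩
            obtain ⟨w', hw', hww'⟩ := F.lift x' (F'.proj w).1 hbw
              (Eq.mpr (congrArg (fun v => v ∈ I.box (F'.proj w).1) hxb) hle)
            obtain ⟨w'', rfl⟩ := h.range w' (by rw [hww']; exact fun h => (F'.proj w).2 h)
            rw [h.proj] at hww'
            have hw2 := hκ.closed y hy w'' ((h.rel _ _).1 (F.rel_trans hw' hx'))
              (by rw [Subtype.ext hww']; exact hκ.mem w hw)
            rw [← hκ.inj _ hw2 _ hw (Subtype.ext hww')]
            exact hw'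
      · rcases h.exists_or x' with ⟨y', rfl⟩ | hxb
        · exact Or.inl ⟨y', ((hz y').1 hx').1, rfl⟩
        · exact Or.inr (F.uniq hx' (F.rel_refl _) (hxb.trans hzb.symm))
    · ext y
      constructor
      · rintro (⟨y', hy', hyy⟩ | hy)
        · exact h.inj hyy ▸ hy'
        · exact (hqz y hy).elim
      · exact fun hy => Or.inl ⟨y, hy, rfl⟩
  · refine ⟨q '' κ', ⟨?_, ?_, ?_, ?_⟩, Set.preimage_image_eq _ h.inj⟩
    · rintro x ⟨y, hy, rfl⟩
      rw [h.proj]; exact hκ.mem y hy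
    · intro a ha
      obtain ⟨y, hy, hya⟩ := hκ.ex ⟨a, fun hab : a = b.1 => hb (hab ▸ ha)⟩ ha
      exact ⟨q y, ⟨y, hy, rfl⟩, (h.proj y).trans (congrArg Subtype.val hya)⟩
    · rintro x ⟨y, hy, rfl⟩ x' ⟨y', hy', rfl⟩ hxy
      rw [h.proj, h.proj] at hxy
      rw [hκ.inj y hy y' hy' (Subtype.ext hxy)]
    · rintro x ⟨y, hy, rfl⟩ x' hx' hxU
      rcases h.exists_or x' with ⟨y', rfl⟩ | hxb
      · refine ⟨y', hκ.closed y hy y' ((h.rel _ _).1 hx') ?_, rfl⟩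
        rw [h.proj] at hxU; exact hxU
      · exact (hb (hxb ▸ hxU)).elim

end DropRel

end BoxFam

theorem encl_drop (i : Emb I G) (b : I.Bang) (i' : Emb (I.drop b) (G.drop (i.bang b)))
    (h : ∀ y, (i'.fV y).1 = i.fV y.1) (x : (G.drop (i.bang b)).V) :
    encl i' x = Subtype.val ⁻¹' encl i x.1 := by
  ext a
  exact and_congr_right fun _ => (Graph.mem_box_del _ _).trans
    (iff_of_eq (congrArg (fun v => x.1 ∈ G.box v) (h a)))

theorem enclE_drop (i : Emb I G) (b : I.Bang) (i' : Emb (I.drop b) (G.drop (i.bang b)))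
    (h : ∀ y, (i'.fV y).1 = i.fV y.1) (a : (G.drop (i.bang b)).E) :
    enclE i' a = Subtype.val ⁻¹' enclE i a.1 := by
  unfold enclE
  rw [encl_drop i b i' h, encl_drop i b i' h]
  rfl

section Drop

variable (hG : G.Nested) (i : Emb I G) (b : I.Bang) (i' : Emb (I.drop b) (G.drop (i.bang b)))
  (h : ∀ y, (i'.fV y).1 = i.fV y.1) {F : BoxFam I} {F' : BoxFam (I.drop b)} {q : F'.X → F.X}
  (hF : DropRel b F F' q)

theorem ne_of_not_isBang {x : G.V} (hx : ¬ G.IsBang x) : x ∉ ({(i.bang b).1} : Set G.V) :=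
  fun hxb => hx ((show x = (i.bang b).1 from hxb) ▸ (i.bang b).2)

include hG in
/-- Instantiating `DROP_b` is instantiating `b` once inside each family of instantiations of the
`!`-boxes around it. -/
def dropEmb : Emb (inst i F) (inst i' F') where
  fV x := ⟨(⟨x.1.1, ne_of_not_isBang i b x.2.1⟩, q ⁻¹' x.1.2), x.2.1, by
    rw [encl_drop i b i' h]; exact hF.isSec_preimage x.2.2⟩
  fE a := ⟨(⟨a.1.1, ne_of_not_isBang i b a.2.1, ne_of_not_isBang i b a.2.1.tgt⟩, q ⁻¹' a.1.2),
    a.2.1, by rw [enclE_drop i b i' h]; exact hF.isSec_preimage a.2.2⟩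
  map_src a := Subtype.ext (Prod.ext rfl (by
    ext z
    refine and_congr_right fun _ => ?_
    change F'.proj z ∈ encl i' _ ↔ F.proj (q z) ∈ encl i _
    rw [encl_drop i b i' h, hF.proj]; rfl))
  map_tgt a := Subtype.ext (Prod.ext rfl (by
    ext z
    refine and_congr_right fun _ => ?_
    change F'.proj z ∈ encl i' _ ↔ F.proj (q z) ∈ encl i _
    rw [encl_drop i b i' h, hF.proj]; rfl))
  map_vty _ := rfl
  map_ety _ := rfl
  map_tag _ := rfl
  injV := by
    rintro ⟨⟨x, κ⟩, hx, hκ⟩ ⟨⟨y, κ'⟩, hy, hκ'⟩ hxy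
    obtain rfl : x = y := congrArg (fun z => z.1.1.1) hxy
    obtain rfl : κ = κ' := hF.eq_of_preimage_eq (fun _ _ ha hc hac => encl_up hG i ha hc hac) hκ hκ'
      (congrArg (fun z => z.1.2) hxy)
    rfl
  injE := by
    rintro ⟨⟨x, κ⟩, hx, hκ⟩ ⟨⟨y, κ'⟩, hy, hκ'⟩ hxy
    obtain rfl : x = y := congrArg (fun z => z.1.1.1) hxy
    obtain rfl : κ = κ' := hF.eq_of_preimage_eq (fun _ _ ha hc hac => enclE_up hG i ha hc hac)
      hκ hκ' (congrArg (fun z => z.1.2) hxy)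
    rfl
  reflects _ _ h _ := (inst_concrete _ _ _ h).elim

theorem dropEmb_isIso : (dropEmb hG i b i' h hF).IsIso := by
  refine ⟨⟨(dropEmb hG i b i' h hF).injV, ?_⟩, ⟨(dropEmb hG i b i' h hF).injE, ?_⟩⟩
  · rintro ⟨⟨x, κ⟩, hx, hκ⟩
    have hκ2 := hκ
    rw [encl_drop i b i' h] at hκ2
    obtain ⟨κ₂, h₂, rfl⟩ := hF.exists_preimage_eq
      (fun _ _ ha hc hac => encl_up hG i ha hc hac) hκ2
    exact ⟨⟨(x.1, κ₂), hx, h₂⟩, rfl⟩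
  · rintro ⟨⟨x, κ⟩, hx, hκ⟩
    have hκ2 := hκ
    rw [enclE_drop i b i' h] at hκ2
    obtain ⟨κ₂, h₂, rfl⟩ := hF.exists_preimage_eq
      (fun _ _ ha hc hac => enclE_up hG i ha hc hac) hκ2
    exact ⟨⟨(x.1, κ₂), hx, h₂⟩, rfl⟩

end Drop

namespace BoxFam

/-- The instantiations of boxes around `b` in which `x` takes place. -/
def enclosing {b : I.Bang} (F : BoxFam (I.drop b)) (x : F.X) : Set F.X :=
  {w | F.rel w x ∧ b.1 ∈ I.box (F.proj w).1}

theorem isSec_enclosing (hI : I.Nested) {b : I.Bang} (F : BoxFam (I.drop b)) {x : F.X}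
    (hx : (F.proj x).1 ∈ I.box b.1) : F.IsSec (above b) (F.enclosing x) where
  mem w hw := ⟨F.bang w, hw.2⟩
  ex a ha := by
    obtain ⟨y, hy, rfl⟩ := F.lift x a ha.1
      ((Graph.mem_box_del _ _).2 (hI.nest _ _ ha.1 b.2 ha.2 hx))
    exact ⟨y, ⟨hy, ha.2⟩, rfl⟩
  inj y hy z hz h := F.uniq hy.1 hz.1 h
  closed y hy z hz hzU := ⟨F.rel_trans hz hy.1, hzU.2⟩

theorem enclosing_eq (hI : I.Nested) {b : I.Bang} (F : BoxFam (I.drop b)) {x y : F.X}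
    (hy : (F.proj y).1 ∈ I.box b.1) (h : F.rel y x) : F.enclosing y = F.enclosing x := by
  ext w
  refine and_congr_left fun hw => ⟨fun hwy => F.rel_trans hwy h, fun hwx => ?_⟩
  have hbw : I.IsBang (F.proj w).1 := F.bang w
  obtain ⟨w', hw', hww⟩ := F.lift y _ (F.bang w)
    ((Graph.mem_box_del _ _).2 (hI.nest _ _ hbw b.2 hw hy))
  exact F.uniq hwx (F.rel_trans hw' h) hww.symm ▸ hw'

/-- The family on `I` by which one has to instantiate in order to get the same as by instantiating
`DROP_b(I)` by `F`. Its elements over `b` are the compatible families of instantiations of the boxes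
around `b`, and an instantiation `x` of a box in `B(b)` restricts to the family in which it takes
place. -/
def extendDrop (hI : I.Nested) (b : I.Bang) (F : BoxFam (I.drop b)) : BoxFam I where
  X := F.X ⊕ {κ : Set F.X // F.IsSec (above b) κ}
  fin := have := F.fin; inferInstance
  proj := Sum.elim (fun x => (F.proj x).1) (fun _ => b.1)
  rel := Sum.elim
    (fun y => Sum.elim (fun x => F.rel y x) (fun κ => y ∈ κ.1))
    (fun μ => Sum.elim (fun x => (F.proj x).1 ∈ I.box b.1 ∧ μ.1 = F.enclosing x)
      (fun κ => μ = κ))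
  bang := by
    rintro (x | κ)
    · exact F.bang x
    · exact b.2
  rel_refl := by
    rintro (x | κ)
    · exact F.rel_refl x
    · rfl
  rel_trans := by
    rintro (x | κ) (y | μ) (z | ν) h1 h2
    · exact F.rel_trans h1 h2
    · exact ⟨hI.nest _ _ b.2 (F.bang y) h1.1
        ((Graph.mem_box_del _ _).1 (F.le h2)), h1.2.trans (F.enclosing_eq hI h1.1 h2)⟩
    · have h1 : z ∈ μ.1 := h1
      rw [h2.2] at h1
      exact h1.1
    · obtain rfl : ν = μ := h1
      exact h2
    · have hb : b.1 ∈ I.box (F.proj y).1 := (κ.2.mem y h2).2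
      have hz : I.IsBang (F.proj z).1 := F.bang z
      exact κ.2.closed y h2 z h1 ⟨F.bang z, hI.nest _ _ hz (F.bang y)
        ((Graph.mem_box_del _ _).1 (F.le h1)) hb⟩
    -- a `!`-vertex other than `b` cannot be both inside and around `B(b)`
    · exact ((F.proj y).2 (hI.anti _ _ (F.bang y) b.2 (κ.2.mem y h2).2 h1.1)).elim
    · obtain rfl : μ = κ := h2
      exact h1
    · exact Eq.trans h1 h2
  le := by
    rintro (x | κ) (y | μ) h
    · exact (Graph.mem_box_del _ _).1 (F.le h)
    · exact h.1
    · exact (κ.2.mem y h).2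
    · exact Graph.mem_box_self _
  lift := by
    rintro (x | κ) a ha h
    · by_cases hab : a = b.1
      · subst hab
        exact ⟨.inr ⟨_, F.isSec_enclosing hI h⟩, ⟨h, rfl⟩, rfl⟩
      · obtain ⟨y, hy, hya⟩ := F.lift x ⟨a, hab⟩ ha ((Graph.mem_box_del _ _).2 h)
        exact ⟨.inl y, hy, congrArg Subtype.val hya⟩
    · by_cases hab : a = b.1
      · exact ⟨.inr κ, rfl, hab.symm⟩
      · obtain ⟨y, hy, hya⟩ := κ.2.ex ⟨a, hab⟩ ⟨ha, h⟩
        exact ⟨.inl y, hy, congrArg Subtype.val hya⟩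
  uniq := by
    rintro (x | κ) (y | μ) (z | ν) h1 h2 he
    · exact congrArg _ (F.uniq h1 h2 (Subtype.ext he))
    · exact ((F.proj y).2 he).elim
    · exact ((F.proj z).2 he.symm).elim
    · exact congrArg _ (Subtype.ext (h1.2.trans h2.2.symm))
    · exact congrArg _ (κ.2.inj y h1 z h2 (Subtype.ext he))
    · exact ((F.proj y).2 he).elim
    · exact ((F.proj z).2 he.symm).elim
    · exact congrArg _ (Eq.trans h1 (Eq.symm h2))

theorem dropRel_extendDrop (hI : I.Nested) (b : I.Bang) (F : BoxFam (I.drop b)) :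
    DropRel b (F.extendDrop hI b) F Sum.inl where
  inj := Sum.inl_injective
  proj _ := rfl
  range := by
    rintro (x | κ) hx
    · exact ⟨x, rfl⟩
    · exact (hx rfl).elim
  rel _ _ := Iff.rfl
  ex κ hκ := ⟨.inr ⟨κ, hκ⟩, rfl, fun _ => Iff.rfl⟩
  ext := by
    rintro (x | κ) (y | μ) hz hz' h
    · exact ((F.proj x).2 hz).elim
    · exact ((F.proj x).2 hz).elim
    · exact ((F.proj y).2 hz').elim
    · exact congrArg _ (Subtype.ext (Set.ext h))

/-- The restriction of a family to the `!`-vertices other than `b`. -/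
def restrictDrop (b : I.Bang) (F : BoxFam I) : BoxFam (I.drop b) where
  X := {x : F.X // F.proj x ≠ b.1}
  fin := have := F.fin; inferInstance
  proj x := ⟨F.proj x.1, x.2⟩
  rel x y := F.rel x.1 y.1
  bang x := F.bang x.1
  rel_refl x := F.rel_refl x.1
  rel_trans := F.rel_trans
  le h := (Graph.mem_box_del _ _).2 (F.le h)
  lift x a ha h := by
    obtain ⟨y, hy, hya⟩ := F.lift x.1 a.1 ha ((Graph.mem_box_del _ _).1 h)
    exact ⟨⟨y, fun hyb => a.2 (hya.symm.trans hyb)⟩, hy, Subtype.ext hya⟩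
  uniq h h' he := Subtype.ext (F.uniq h h' (congrArg Subtype.val he))

/-- As there is only one compatible family of instantiations of the boxes around a `!`-vertex that
lies in no other box, `DropRel` asks for exactly one element over it. -/
theorem dropRel_restrictDrop {b : I.Bang} (hb : I.IsTop b.1) (F : BoxFam I) {z : F.X}
    (hz : F.fib b.1 = {z}) : DropRel b F (F.restrictDrop b) Subtype.val where
  inj := Subtype.val_injective
  proj _ := rfl
  range x hx := ⟨⟨x, hx⟩, rfl⟩
  rel _ _ := Iff.rfl
  ex κ hκ := by
    have hzb : z ∈ F.fib b.1 := by rw [hz]; rfl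
    have hzb : F.proj z = b.1 := hzb
    refine ⟨z, hzb, fun y => iff_of_false (fun h => ?_) (fun h => ?_)⟩
    · exact y.2 (hb _ (F.bang y.1)
        (Eq.mp (congrArg (fun v => v ∈ I.box (F.proj y.1)) hzb) (F.le h)))
    · have := hκ.mem y h
      exact y.2 (hb _ this.1 this.2)
  ext x y hx hy _ := by
    have hx : x ∈ F.fib b.1 := hx
    have hy : y ∈ F.fib b.1 := hy
    rw [hz] at hx hy
    exact Eq.trans hx (Eq.symm hy)

end BoxFam

namespace Span

variable {e : Span T Tag}

theorem Good.inst_drop_iso (h : e.Good) (b : e.I.Bang) {F : BoxFam e.I}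
    {F' : BoxFam (e.drop b).I} {q : F'.X → F.X} (hF : DropRel b F F' q) :
    (e.inst F).Iso ((e.drop b).inst F') :=
  ⟨dropEmb h.L e.left b (e.drop b).left (fun _ => rfl) hF,
    dropEmb h.I (Emb.id e.I) b (Emb.id (e.drop b).I) (fun _ => rfl) hF,
    dropEmb h.R e.right b (e.drop b).right (fun _ => rfl) hF,
    dropEmb_isIso _ _ _ _ _ _, dropEmb_isIso _ _ _ _ _ _, dropEmb_isIso _ _ _ _ _ _, rfl, rfl⟩

theorem Good.inst_copy_iso (h : e.Good) (b : e.I.Bang) (F : BoxFam (e.copy b).I) :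
    ((e.copy b).inst F).Iso (e.inst (F.pushCopy h.I b)) :=
  inst_iso_of_instMap (instMapCopy h.I h.L e.left b (e.copy b).left (fun _ => rfl) F)
    (instMapCopy h.I h.I (Emb.id e.I) b (Emb.id (e.copy b).I) (by rintro (y | y) <;> rfl) F)
    (instMapCopy h.I h.R e.right b (e.copy b).right (fun _ => rfl) F)
    (by rintro (y | y) <;> rfl) (by rintro (y | y) <;> rfl) (by rintro (y | y) <;> rfl)
    (by rintro (y | y) <;> rfl)

theorem Good.copy (h : e.Good) (b : e.I.Bang) : (e.copy b).Good where
  L := h.L.copy _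
  I := h.I.copy _
  R := h.R.copy _
  coverL := by
    rintro (x | x) hx
    · obtain ⟨y, hy⟩ := h.coverL x hx
      exact ⟨.inl y, congrArg Sum.inl hy⟩
    · obtain ⟨y, hy⟩ := h.coverL x.1 hx
      exact ⟨.inr ⟨y, (e.left.mem_box b.2).1 (hy ▸ x.2)⟩, congrArg Sum.inr (Subtype.ext hy)⟩
  coverR := by
    rintro (x | x) hx
    · obtain ⟨y, hy⟩ := h.coverR x hx
      exact ⟨.inl y, congrArg Sum.inl hy⟩
    · obtain ⟨y, hy⟩ := h.coverR x.1 hx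
      exact ⟨.inr ⟨y, (e.right.mem_box b.2).1 (hy ▸ x.2)⟩, congrArg Sum.inr (Subtype.ext hy)⟩

theorem Good.drop (h : e.Good) (b : e.I.Bang) : (e.drop b).Good where
  L := h.L.del _
  I := h.I.del _
  R := h.R.del _
  coverL x hx := by
    obtain ⟨y, hy⟩ := h.coverL x.1 hx
    exact ⟨⟨y, fun hyb => x.2 (hy ▸ congrArg e.left.fV hyb)⟩, Subtype.ext hy⟩
  coverR x hx := by
    obtain ⟨y, hy⟩ := h.coverR x.1 hx
    exact ⟨⟨y, fun hyb => x.2 (hy ▸ congrArg e.right.fV hyb)⟩, Subtype.ext hy⟩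

theorem Good.exp (h : e.Good) (b : e.I.Bang) : (e.exp b).Good := (h.copy b).drop _

end Span

/-! ### Expanding a top-level box -/

namespace BoxFam.DropRel

variable {b : I.Bang} {F : BoxFam I} {F' : BoxFam (I.drop b)} {q : F'.X → F.X}

theorem exists_fib_eq_singleton (h : DropRel b F F' q) (hb : I.IsTop b.1) :
    ∃ z, F.fib b.1 = {z} := by
  have hrel : ∀ z, F.proj z = b.1 → ∀ y, ¬ F.rel (q y) z := fun z hz y hy =>
    h.proj_ne y (hb _ (F.bang _) (hz ▸ F.le hy))
  obtain ⟨z, hz, -⟩ := h.ex ∅ ⟨fun _ h => h.elim,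
    fun a ha => (a.2 (hb _ ha.1 ha.2)).elim, fun _ h => h.elim, fun _ h => h.elim⟩
  refine ⟨z, Set.ext fun z' => ⟨fun hz' => ?_, fun hz' => ?_⟩⟩
  · exact h.ext _ _ hz' hz fun y => iff_of_false (hrel _ hz' y) (hrel _ hz y)
  · rw [show z' = z from hz']; exact hz

theorem ncard_fib (h : DropRel b F F' q) (c : (I.drop b).V) :
    (F.fib c.1).ncard = (F'.fib c).ncard := by
  rw [← Set.ncard_image_of_injective _ h.inj]
  congr 1
  ext x
  constructor
  · intro hx
    obtain ⟨y, rfl⟩ := h.range x (fun hxb => c.2 ((show F.proj x = c.1 from hx).symm.trans hxb))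
    exact ⟨y, Subtype.ext ((h.proj y).symm.trans hx), rfl⟩
  · rintro ⟨y, hy, rfl⟩
    exact (h.proj y).trans (congrArg Subtype.val hy)

theorem card_eq (h : DropRel b F F' q) :
    Nat.card F.X = Nat.card F'.X + (F.fib b.1).ncard := by
  have := F.fin
  have := F'.fin
  rw [← Set.ncard_univ F.X, ← Set.ncard_univ F'.X, ← Set.ncard_image_of_injective _ h.inj,
    ← Set.ncard_union_eq _ (Set.toFinite _) (Set.toFinite _)]
  · congr 1
    ext x
    refine iff_of_true trivial ?_
    rcases h.exists_or x with ⟨y, hy⟩ | hx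
    · exact Or.inl ⟨y, trivial, hy⟩
    · exact Or.inr hx
  · rw [Set.disjoint_left]
    rintro x ⟨y, -, rfl⟩
    exact h.proj_ne y

end BoxFam.DropRel

theorem BoxFam.ncard_fib_pushCopy_self (hI : I.Nested) (b : I.Bang) (F : BoxFam (I.copy b)) :
    ((F.pushCopy hI b).fib b.1).ncard =
      (F.fib (.inl b.1)).ncard + (F.fib (.inr ⟨b.1, Graph.mem_box_self _⟩)).ncard := by
  have := F.fin
  rw [← Set.ncard_union_eq _ (Set.toFinite _) (Set.toFinite _)]
  · congr 1
    ext x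
    change Graph.base (F.proj x) = b.1 ↔ F.proj x = _ ∨ F.proj x = _
    rcases F.proj x with y | y
    · exact ⟨fun h => Or.inl (congrArg _ h),
        fun h => h.elim (fun h => Sum.inl_injective h) (fun h => by cases h)⟩
    · exact ⟨fun h => Or.inr (congrArg _ (Subtype.ext h)),
        fun h => h.elim (fun h => by cases h)
          (fun h => congrArg Subtype.val (Sum.inr_injective h))⟩
  · rw [Set.disjoint_left]
    intro x hx hx'
    have hx : F.proj x = _ := hx
    have hx' : F.proj x = _ := hx'
    rw [hx] at hx'
    cases hx'

theorem BoxFam.fib_pushCopy_of_notMem (hI : I.Nested) (b : I.Bang) (F : BoxFam (I.copy b))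
    {c : I.V} (hc : c ∉ I.box b.1) : (F.pushCopy hI b).fib c = F.fib (.inl c) := by
  ext x
  change Graph.base (F.proj x) = c ↔ F.proj x = _
  rcases F.proj x with y | y
  · exact ⟨fun h => congrArg _ h, fun h => Sum.inl_injective h⟩
  · exact iff_of_false (fun h => hc (h ▸ y.2)) (fun h => by cases h)

theorem BoxFam.fib_pullCopy_copy1 (hI : I.Nested) (b : I.Bang) (F : BoxFam I) {z : F.X}
    (hz : F.proj z = b.1) :
    (F.pullCopy hI b {z}).fib (.inr ⟨b.1, Graph.mem_box_self _⟩) = {z} := by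
  ext x
  change F.pullProj b {z} x = _ ↔ x = z
  constructor
  · intro hx
    have h1 : F.proj x = b.1 := (F.base_pullProj b {z} x).symm.trans (congrArg Graph.base hx)
    obtain ⟨y, rfl, hyx, hyb⟩ := (F.isRight_pullProj b {z} x).1 (congrArg Sum.isRight hx)
    exact (F.uniq hyx (F.rel_refl x) (hyb.trans h1.symm)).symm
  · intro hx
    refine Graph.copy_ext ((F.base_pullProj b _ x).trans (hx ▸ hz)) fun _ => ?_
    exact (F.isRight_pullProj b _ x).2 ⟨z, rfl, hx ▸ F.rel_refl z, hz⟩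

namespace Span

variable {e : Span T Tag}

/-- The `!`-vertex of `EXP_b(e)` corresponding to a `!`-vertex of the first copy of `e`. -/
def expVertex (e : Span T Tag) (b : e.I.Bang) (c : e.I.V) : (e.exp b).I.V :=
  ⟨Sum.inl c, by rintro ⟨⟩⟩

/-- `ExpRel b F F'`: instantiating `EXP_b(e)` by `F'` amounts to instantiating `e` by `F`, which
has one more instantiation of `b`. -/
structure ExpRel (e : Span T Tag) (b : e.I.Bang) (F : BoxFam e.I) (F' : BoxFam (e.exp b).I) :
    Prop where
  iso : ((e.exp b).inst F').Iso (e.inst F)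
  fib : (F.fib b.1).ncard = (F'.fib (e.keep b).1).ncard + 1
  fib_eq : ∀ c, c ∉ e.I.box b.1 → (F.fib c).ncard = (F'.fib (e.expVertex b c)).ncard
  card : Nat.card F.X = Nat.card F'.X + 1

theorem Good.expRel_of_dropRel (h : e.Good) (b : e.I.Bang) (hb : e.I.IsTop b.1)
    {F : BoxFam (e.copy b).I} {F' : BoxFam (e.exp b).I} {q : F'.X → F.X}
    (hq : DropRel (e.copy1 b) F F' q) : e.ExpRel b (F.pushCopy h.I b) F' := by
  obtain ⟨z, hz⟩ := hq.exists_fib_eq_singleton (Graph.IsTop.copy h.I hb)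
  have h1 : (F.fib (e.copy1 b).1).ncard = 1 := by rw [hz, Set.ncard_singleton]
  refine ⟨((h.copy b).inst_drop_iso (e.copy1 b) hq).symm.trans (h.inst_copy_iso b F), ?_, ?_, ?_⟩
  · exact (ncard_fib_pushCopy_self h.I b F).trans
      (congrArg₂ (· + ·) (hq.ncard_fib (e.keep b).1) h1)
  · intro c hc
    exact (congrArg Set.ncard (fib_pushCopy_of_notMem h.I b F hc)).trans
      (hq.ncard_fib (e.expVertex b c))
  · exact hq.card_eq.trans (congrArg _ h1)

theorem Good.exists_expRel_push (h : e.Good) (b : e.I.Bang) (hb : e.I.IsTop b.1)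
    (F' : BoxFam (e.exp b).I) : ∃ F, e.ExpRel b F F' :=
  ⟨_, h.expRel_of_dropRel b hb (F'.dropRel_extendDrop (h.copy b).I (e.copy1 b))⟩

theorem Good.exists_expRel_pull (h : e.Good) (b : e.I.Bang) (hb : e.I.IsTop b.1)
    (F : BoxFam e.I) (hF : (F.fib b.1).Nonempty) : ∃ F', e.ExpRel b F F' := by
  obtain ⟨z, hz⟩ := hF
  have := h.expRel_of_dropRel b hb (dropRel_restrictDrop (b := e.copy1 b)
    (Graph.IsTop.copy h.I hb) (F.pullCopy h.I b {z}) (fib_pullCopy_copy1 h.I b F hz))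
  rw [pushCopy_pullCopy] at this
  exact ⟨_, this⟩

/-- The fixed `!`-vertices lie in no other `!`-box. -/
def FixedTop (e : Span T Tag) : Prop := ∀ c, e.I.tag c ≠ none → e.I.IsTop c

theorem IsEquation.fixedTop (h : e.IsEquation) : e.FixedTop :=
  fun c hc => Graph.TopLevel.isTop (h.fixed_topLevel c hc)

theorem FixedTop.kill (h : e.FixedTop) (b : e.I.Bang) : (e.kill b).FixedTop :=
  fun c hc => Graph.IsTop.del (h c.1 hc)

theorem FixedTop.exp (he : e.Good) (h : e.FixedTop) (b : e.I.Bang) : (e.exp b).FixedTop := by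
  rintro ⟨c | c, hc'⟩ hc
  · exact Graph.IsTop.del (Graph.IsTop.copy he.I (h c hc))
  · exact Graph.IsTop.del (Graph.IsTop.copy he.I (h c.1 hc))

theorem isTop_keep (he : e.Good) {b : e.I.Bang} (hb : e.I.IsTop b.1) :
    (e.exp b).I.IsTop (e.keep b).1 :=
  Graph.IsTop.del (Graph.IsTop.copy he.I hb)

/-- A `!`-vertex of `EXP_b(e)` that is fixed, other than `b`, is the only copy of a `!`-vertex
of `e`. -/
theorem FixedTop.exists_expVertex (h : e.FixedTop) {b : e.I.Bang} {c : (e.exp b).I.V}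
    (hc : (e.exp b).I.tag c ≠ none) (hcb : c ≠ (e.keep b).1) :
    ∃ c', c = e.expVertex b c' ∧ c' ∉ e.I.box b.1 := by
  rcases c with ⟨c | c, hc'⟩
  · refine ⟨c, rfl, fun hm => hcb ?_⟩
    obtain rfl := h c hc b.1 b.2 hm
    rfl
  · have := h c.1 hc b.1 b.2 c.2
    exact (hc' (congrArg Sum.inr (Subtype.ext this.symm))).elim

theorem FixedTop.notMem_box (h : e.FixedTop) {b : e.I.Bang} {c : e.I.V} (hc : e.I.tag c ≠ none)
    (hcb : c ≠ b.1) : c ∉ e.I.box b.1 := fun hm => hcb (h c hc b.1 b.2 hm).symm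

/-- The family has `lam y` instantiations of each `y`-fixed `!`-vertex, apart from those in `S`. -/
def RespectsOff (lam : Tag → ℕ) (F : BoxFam I) (S : Set I.V) : Prop :=
  ∀ c y, c ∉ S → I.tag c = some y → (F.fib c).ncard = lam y

theorem ExpRel.respectsOff_iff (h : e.FixedTop) {b : e.I.Bang} {F : BoxFam e.I}
    {F' : BoxFam (e.exp b).I} (hF : e.ExpRel b F F') (lam : Tag → ℕ) :
    RespectsOff lam F {b.1} ↔ RespectsOff lam F' {(e.keep b).1} := by
  constructor
  · intro hr c y hc hy
    obtain ⟨c, rfl, hcb⟩ := h.exists_expVertex (by rw [hy]; exact Option.some_ne_none y) hc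
    rw [← hF.fib_eq c hcb]
    exact hr c y (fun hcb' => hcb (Or.inl hcb')) hy
  · intro hr c y hc hy
    rw [hF.fib_eq c (h.notMem_box (by rw [hy]; exact Option.some_ne_none y) hc)]
    exact hr _ y (fun hcb => hc (Sum.inl_injective (congrArg Subtype.val hcb))) hy

theorem KillRel.respectsOff_iff (h : e.FixedTop) {b : e.I.Bang} {F : BoxFam e.I}
    {F' : BoxFam (e.kill b).I} (hF : e.KillRel b F F') (lam : Tag → ℕ) :
    RespectsOff lam F {b.1} ↔ RespectsOff lam F' ∅ := by
  constructor
  · intro hr c y _ hy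
    exact (hF.fib_eq c.1 c.2).symm.trans (hr c.1 y (fun hcb => c.2 (Or.inl hcb)) hy)
  · intro hr c y hc hy
    have hc' := h.notMem_box (by rw [hy]; exact Option.some_ne_none y) hc
    rw [hF.fib_eq c hc']
    exact hr ⟨c, hc'⟩ y (fun h => h) hy

theorem Good.expKill {n : ℕ} (h : e.Good) (b : e.I.Bang) : (expKill n e b).Good := by
  induction n generalizing e with
  | zero => exact h.kill b
  | succ n ih => exact ih (h.exp b) (e.keep b)

theorem FixedTop.expKill {n : ℕ} (he : e.Good) (h : e.FixedTop) (b : e.I.Bang) :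
    (expKill n e b).FixedTop := by
  induction n generalizing e with
  | zero => exact h.kill b
  | succ n ih => exact ih (he.exp b) (h.exp he b) (e.keep b)

/-- An instantiation of `n` operations `EXP_b` and one `KILL_b` is an instantiation with exactly `n`
elements over `b`. -/
theorem Good.exists_of_expKill (lam : Tag → ℕ) {n : ℕ} (he : e.Good) (h : e.FixedTop)
    (b : e.I.Bang) (hb : e.I.IsTop b.1) (F' : BoxFam (Span.expKill n e b).I)
    (hF' : RespectsOff lam F' ∅) :
    ∃ F : BoxFam e.I, ((Span.expKill n e b).inst F').Iso (e.inst F) ∧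
      (F.fib b.1).ncard = n ∧ RespectsOff lam F {b.1} := by
  induction n generalizing e with
  | zero =>
    have hF := he.killRel_push b F'
    exact ⟨_, hF.iso, by rw [hF.fib, Set.ncard_empty], (hF.respectsOff_iff h lam).2 hF'⟩
  | succ n ih =>
    obtain ⟨F₁, h1, h2, h3⟩ := ih (he.exp b) (h.exp he b) (e.keep b) (isTop_keep he hb) F' hF'
    obtain ⟨F, hF⟩ := he.exists_expRel_push b hb F₁
    exact ⟨F, h1.trans hF.iso, by rw [hF.fib, h2], (hF.respectsOff_iff h lam).2 h3⟩

theorem card_kill_lt (b : e.I.Bang) : Nat.card (e.kill b).I.V < Nat.card e.I.V :=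
  have := e.I.finV
  Finite.card_subtype_lt (p := fun x => x ∉ e.I.box b.1) (x := b.1)
    (fun h => h (Graph.mem_box_self _))

/-- Conversely, an instantiation with exactly `n` elements over `b` is an instantiation of `n`
operations `EXP_b` and one `KILL_b`. The family gets smaller if `n ≠ 0`, and the graph otherwise. -/
theorem Good.exists_expKill (lam : Tag → ℕ) {n : ℕ} (he : e.Good) (h : e.FixedTop)
    (b : e.I.Bang) (hb : e.I.IsTop b.1) (F : BoxFam e.I) (hn : (F.fib b.1).ncard = n)
    (hF : RespectsOff lam F {b.1}) :
    ∃ F' : BoxFam (Span.expKill n e b).I, ((Span.expKill n e b).inst F').Iso (e.inst F) ∧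
      RespectsOff lam F' ∅ ∧
      Prod.Lex (· < ·) (· < ·) (Nat.card F'.X, Nat.card (Span.expKill n e b).I.V)
        (Nat.card F.X, Nat.card e.I.V) := by
  have := F.fin
  induction n generalizing e with
  | zero =>
    obtain ⟨F', hF'⟩ := he.exists_killRel_pull b F ((Set.ncard_eq_zero (Set.toFinite _)).1 hn)
    refine ⟨F', hF'.iso, (hF'.respectsOff_iff h lam).1 hF, ?_⟩
    rw [hF'.card]
    exact Prod.Lex.right _ (card_kill_lt b)
  | succ n ih =>
    obtain ⟨F₁, hF₁⟩ := he.exists_expRel_pull b hb F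
      (Set.nonempty_of_ncard_ne_zero (by rw [hn]; exact n.succ_ne_zero))
    have h1 : (F₁.fib (e.keep b).1).ncard = n := by
      have := hF₁.fib
      omega
    have hc := hF₁.card
    obtain ⟨F', h2, h3, h4⟩ := ih (he.exp b) (h.exp he b) (e.keep b) (isTop_keep he hb) F₁ h1
      ((hF₁.respectsOff_iff h lam).1 hF) F₁.fin
    refine ⟨F', h2.trans hF₁.iso, h3, Prod.Lex.left _ _ ?_⟩
    rw [Prod.lex_def] at h4
    change Nat.card F'.X < Nat.card F₁.X ∨ Nat.card F'.X = Nat.card F₁.X ∧ _ at h4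
    rcases h4 with h4 | h4 <;> omega

end Span

/-! ### Concrete instances are instantiations -/

/-- The family of instantiations of no `!`-boxes at all. -/
def BoxFam.empty (I : Graph T Tag) : BoxFam I where
  X := Empty
  fin := inferInstance
  proj := Empty.elim
  rel _ _ := False
  bang x := x.elim
  rel_refl x := x.elim
  rel_trans h := h.elim
  le h := h.elim
  lift x := x.elim
  uniq h := h.elim

theorem encl_eq_empty (hI : I.Concrete) (i : Emb I G) (x : G.V) : encl i x = ∅ :=
  Set.eq_empty_of_forall_notMem fun a ha => hI a ha.1

theorem enclE_eq_empty (hI : I.Concrete) (i : Emb I G) (a : G.E) : enclE i a = ∅ := by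
  rw [enclE, encl_eq_empty hI, encl_eq_empty hI, Set.union_empty]

theorem BoxFam.isSec_empty (F : BoxFam I) : F.IsSec ∅ ∅ :=
  ⟨fun _ h => h.elim, fun _ h => h.elim, fun _ h => h.elim, fun _ h => h.elim⟩

theorem BoxFam.eq_empty_of_concrete (F : BoxFam I) (hI : I.Concrete) (κ : Set F.X) : κ = ∅ :=
  Set.eq_empty_of_forall_notMem fun x _ => hI _ (F.bang x)

/-- A concrete graph is its own instantiation. -/
def concreteEmb (hI : I.Concrete) (hG : G.Concrete) (i : Emb I G) (F : BoxFam I) :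
    Emb G (inst i F) where
  fV x := ⟨(x, ∅), hG x, by rw [encl_eq_empty hI]; exact F.isSec_empty⟩
  fE a := ⟨(a, ∅), hG _, by rw [enclE_eq_empty hI]; exact F.isSec_empty⟩
  map_src _ := Subtype.ext (Prod.ext rfl (Set.empty_inter _))
  map_tgt _ := Subtype.ext (Prod.ext rfl (Set.empty_inter _))
  map_vty _ := rfl
  map_ety _ := rfl
  map_tag x := by
    by_contra h
    exact hG x (G.tag_bang x (Ne.symm h))
  injV _ _ h := congrArg (fun z => z.1.1) h
  injE _ _ h := congrArg (fun z => z.1.1) h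
  reflects _ _ hb _ := (inst_concrete _ _ _ hb).elim

theorem concreteEmb_isIso (hI : I.Concrete) (hG : G.Concrete) (i : Emb I G) (F : BoxFam I) :
    (concreteEmb hI hG i F).IsIso := by
  refine ⟨⟨(concreteEmb hI hG i F).injV, ?_⟩, ⟨(concreteEmb hI hG i F).injE, ?_⟩⟩
  · rintro ⟨⟨x, κ⟩, hx, hκ⟩
    exact ⟨x, Subtype.ext (Prod.ext rfl (F.eq_empty_of_concrete hI κ).symm)⟩
  · rintro ⟨⟨x, κ⟩, hx, hκ⟩
    exact ⟨x, Subtype.ext (Prod.ext rfl (F.eq_empty_of_concrete hI κ).symm)⟩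

theorem Graph.Nested.of_emb (f : Emb G H) (h : H.Nested) : G.Nested where
  nest b b' hb hb' hm x hx := by
    rw [← f.mem_box hb] at hm ⊢
    rw [← f.mem_box hb'] at hx
    exact h.nest _ _ (f.isBang_iff.2 hb) (f.isBang_iff.2 hb') hm hx
  anti b b' hb hb' h1 h2 := by
    rw [← f.mem_box hb] at h1
    rw [← f.mem_box hb'] at h2
    exact f.injV (h.anti _ _ (f.isBang_iff.2 hb) (f.isBang_iff.2 hb') h1 h2)

theorem Graph.Concrete.of_emb (f : Emb G H) (h : H.Concrete) : G.Concrete :=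
  fun x hx => h (f.fV x) (f.isBang_iff.2 hx)

namespace Span

variable {e e' f g : Span T Tag}

theorem Concrete.iso_inst (h : e.Concrete) (F : BoxFam e.I) : e.Iso (e.inst F) := by
  have hI := Graph.Concrete.of_emb e.left h.1
  exact ⟨concreteEmb hI h.1 e.left F, concreteEmb hI hI (Emb.id e.I) F,
    concreteEmb hI h.2 e.right F, concreteEmb_isIso _ _ _ _, concreteEmb_isIso _ _ _ _,
    concreteEmb_isIso _ _ _ _, rfl, rfl⟩

theorem Iso.good (h : e'.Iso e) (he : e.Good) : e'.Good := by
  obtain ⟨l, m, r, hl, hm, hr, h1, h2⟩ := h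
  refine ⟨.of_emb l he.L, .of_emb m he.I, .of_emb r he.R, fun x hx => ?_, fun x hx => ?_⟩
  · obtain ⟨y, hy⟩ := he.coverL _ (l.isBang_iff.2 hx)
    obtain ⟨y, rfl⟩ := hm.1.2 y
    exact ⟨y, l.injV ((congrArg (fun k => k.fV y) h1).trans hy)⟩
  · obtain ⟨y, hy⟩ := he.coverR _ (r.isBang_iff.2 hx)
    obtain ⟨y, rfl⟩ := hm.1.2 y
    exact ⟨y, r.injV ((congrArg (fun k => k.fV y) h2).trans hy)⟩

theorem Iso.concrete (h : e'.Iso e) (he : e.Concrete) : e'.Concrete := by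
  obtain ⟨l, m, r, -⟩ := h
  exact ⟨.of_emb l he.1, .of_emb r he.2⟩

theorem Good.concrete (h : e.Good) (hI : e.I.Concrete) : e.Concrete := by
  constructor
  · intro x hx
    obtain ⟨y, rfl⟩ := h.coverL x hx
    exact hI y (e.left.isBang_iff.1 hx)
  · intro x hx
    obtain ⟨y, rfl⟩ := h.coverR x hx
    exact hI y (e.right.isBang_iff.1 hx)

/-- Every concrete instance is an instantiation. -/
theorem Instance.exists_inst (h : e.Instance g) (he : e.Good) (hg : g.Concrete) :
    ∃ F, (e.inst F).Iso g := by
  induction h with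
  | iso h =>
    have hc := h.concrete hg
    exact ⟨.empty _, (hc.iso_inst _).symm.trans h⟩
  | copy b _ ih =>
    obtain ⟨F, hF⟩ := ih (he.copy b) hg
    exact ⟨_, (he.inst_copy_iso b F).symm.trans hF⟩
  | drop b _ ih =>
    obtain ⟨F, hF⟩ := ih (he.drop b) hg
    exact ⟨_, (he.inst_drop_iso b (F.dropRel_extendDrop he.I b)).trans hF⟩
  | kill b _ ih =>
    obtain ⟨F, hF⟩ := ih (he.kill b) hg
    exact ⟨_, (he.killRel_push b F).iso.symm.trans hF⟩

/-- Every instantiation is an instance: a `!`-vertex lying in no other `!`-box is expanded or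
killed, according to whether any instantiations of it are left. -/
theorem Good.instance_inst {e : Span T Tag} (he : e.Good) (F : BoxFam e.I) :
    e.Instance (e.inst F) := by
  have := F.fin
  by_cases hI : ∃ b, e.I.IsBang b
  · obtain ⟨b, hb, hbt⟩ := he.I.exists_isTop hI
    by_cases hF : F.fib b = ∅
    · obtain ⟨F', hF'⟩ := he.exists_killRel_pull ⟨b, hb⟩ F hF
      have := card_kill_lt (e := e) ⟨b, hb⟩
      have := hF'.card
      exact .kill ⟨b, hb⟩ (((he.kill _).instance_inst F').trans_iso hF'.iso)
    · obtain ⟨F', hF'⟩ := he.exists_expRel_pull ⟨b, hb⟩ hbt F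
        (Set.nonempty_iff_ne_empty.2 hF)
      have := hF'.card
      exact .copy ⟨b, hb⟩ (.drop (e.copy1 ⟨b, hb⟩)
        (((he.exp _).instance_inst F').trans_iso hF'.iso))
  · exact .iso ((he.concrete fun x hx => hI ⟨x, hx⟩).iso_inst F)
termination_by (Nat.card F.X, Nat.card e.I.V)
decreasing_by
  · rw [Prod.lex_def]; right; simp_all
  · rw [Prod.lex_def]; left; simp_all

/-- Every concrete instance of `X_lam(e)` is an instantiation of `e` in which each fixed
`!`-vertex is instantiated as often as `lam` says. -/
theorem FixedExpansion.exists_inst {lam : Tag → ℕ} (h : e.FixedExpansion lam f) (he : e.Good)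
    (ht : e.FixedTop) (hfg : f.Instance g) (hg : g.Concrete) :
    ∃ F : BoxFam e.I, RespectsOff lam F ∅ ∧ (e.inst F).Iso g := by
  induction h with
  | done hnone hiso =>
    obtain ⟨F, hF⟩ := hfg.exists_inst (hiso.symm.good he) hg
    obtain ⟨l, m, r, hl, hm, hr, h1, h2⟩ := hiso.symm
    refine ⟨_, fun c y _ hy => ?_, (Iso.inst l m r hl hm hr h1 h2 F).symm.trans hF⟩
    rw [hnone c] at hy
    cases hy
  | @step e f b y hby _ ih =>
    obtain ⟨F', h1, h2⟩ := ih (he.expKill b) (ht.expKill he b) hfg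
    obtain ⟨F, h3, h4, h5⟩ := he.exists_of_expKill lam ht b
      (ht b.1 (by rw [hby]; exact Option.some_ne_none y)) F' h1
    refine ⟨F, fun c z _ hz => ?_, h3.symm.trans h2⟩
    by_cases hcb : c = b.1
    · subst hcb
      rw [hby] at hz
      cases hz
      exact h4
    · exact h5 c z hcb hz

/-- Every instantiation of `e` in which each fixed `!`-vertex is instantiated as often as `lam` says
is an instance of `X_lam(e)`. -/
theorem Good.exists_fixedExpansion {lam : Tag → ℕ} {e : Span T Tag} (he : e.Good) (ht : e.FixedTop)
    (F : BoxFam e.I) (hF : RespectsOff lam F ∅) :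
    ∃ f, e.FixedExpansion lam f ∧ f.Instance (e.inst F) := by
  by_cases h : ∀ b, e.I.tag b = none
  · exact ⟨e, .done h (.refl e), he.instance_inst F⟩
  · obtain ⟨b, hb⟩ := not_forall.1 h
    obtain ⟨y, hy⟩ := Option.ne_none_iff_exists'.1 hb
    let b' : e.I.Bang := ⟨b, e.I.tag_bang b hb⟩
    obtain ⟨F', h1, h2, h3⟩ := he.exists_expKill lam ht b' (ht b hb) F
      (hF b y (fun h => h) hy) (fun c z _ hz => hF c z (fun h => h) hz)
    obtain ⟨f, hf, hf'⟩ := (he.expKill b').exists_fixedExpansion (ht.expKill he b') F' h2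
    exact ⟨f, .step b' y hy hf, hf'.trans_iso h1⟩
termination_by (Nat.card F.X, Nat.card e.I.V)
decreasing_by exact h3

end Span

/-! ### Derivability -/

/-- Axioms that are derivable from other axioms can be replaced by these. -/
theorem StringDerivable.cut {S S' : Set (Span T Tag)} (hS : ∀ e ∈ S, StringDerivable S' e)
    {e : Span T Tag} (h : StringDerivable S e) : StringDerivable S' e := by
  induction h with
  | ax h => exact hS _ h
  | refl i h => exact .refl i h
  | symm _ ih => exact .symm ih
  | trans t ht _ _ ih ih' => exact .trans t ht ih ih'
  | leibniz m d r g h c hD hD' hp hp' he _ ih => exact .leibniz m d r g h c hD hD' hp hp' he ih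
  | homeo φ ψ hφ hψ he _ ih => exact .homeo φ ψ hφ hψ he ih

namespace Span

variable {e f g : Span T Tag}

/-- `g` is an instantiation of `e` in which the `y`-fixed `!`-vertices are instantiated `lam y`
times: up to isomorphism, `g` is a concrete instance of `X_lam(e)`. -/
def IsExpansion (lam : Tag → ℕ) (e g : Span T Tag) : Prop :=
  ∃ F : BoxFam e.I, RespectsOff lam F ∅ ∧ (e.inst F).Iso g

theorem IsExpansion.concrete {lam : Tag → ℕ} (h : e.IsExpansion lam g) : g.Concrete := by
  obtain ⟨F, -, hF⟩ := h
  exact hF.symm.concrete (e.inst_concrete F)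

theorem IsExpansion.exists_fixedExpansion {lam : Tag → ℕ} (h : e.IsExpansion lam g)
    (he : e.Good) (ht : e.FixedTop) : ∃ f, e.FixedExpansion lam f ∧ f.Instance g := by
  obtain ⟨F, h1, h2⟩ := h
  obtain ⟨f, hf, hf'⟩ := he.exists_fixedExpansion ht F h1
  exact ⟨f, hf, hf'.trans_iso h2⟩

theorem IsExpansion.congr {lam lam' : Tag → ℕ} (h : e.IsExpansion lam g)
    (hlam : ∀ y ∈ e.tags, lam y = lam' y) : e.IsExpansion lam' g := by
  obtain ⟨F, h1, h2⟩ := h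
  exact ⟨F, fun c y hc hy => (h1 c y hc hy).trans (hlam y ⟨c, hy⟩), h2⟩

theorem Good.fix (he : e.Good) (b : e.I.Bang) (x : Tag) : (e.fix b x).Good where
  L := ⟨he.L.nest, he.L.anti⟩
  I := ⟨he.I.nest, he.I.anti⟩
  R := ⟨he.R.nest, he.R.anti⟩
  coverL := he.coverL
  coverR := he.coverR

theorem tag_fix_self (b : e.I.Bang) (x : Tag) : (e.fix b x).I.tag b.1 = some x := if_pos rfl

theorem tag_fix_of_ne {b : e.I.Bang} {x : Tag} {c : e.I.V} (h : c ≠ b.1) :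
    (e.fix b x).I.tag c = e.I.tag c := if_neg h

theorem FixedTop.fix (ht : e.FixedTop) {b : e.I.Bang} (hb : e.I.IsTop b.1) (x : Tag) :
    (e.fix b x).FixedTop := by
  intro c hc
  by_cases h : c = b.1
  · subst h; exact hb
  · rw [tag_fix_of_ne (e := e) h] at hc
    exact ht c hc

theorem tags_fix_subset (b : e.I.Bang) (x : Tag) : (e.fix b x).tags ⊆ insert x e.tags := by
  rintro y ⟨c, hc⟩
  by_cases h : c = b.1
  · subst h
    rw [tag_fix_self] at hc
    cases hc
    exact Or.inl rfl
  · rw [tag_fix_of_ne (e := e) h] at hc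
    exact Or.inr ⟨c, hc⟩

theorem tags_kill_subset (b : e.I.Bang) : (e.kill b).tags ⊆ e.tags := by
  rintro y ⟨c, hc⟩
  exact ⟨c.1, hc⟩

theorem tags_exp_subset (b : e.I.Bang) : (e.exp b).tags ⊆ e.tags := by
  rintro y ⟨⟨c | c, _⟩, hc⟩
  · exact ⟨c, hc⟩
  · exact ⟨c.1, hc⟩

end Span

/-! ### Instantiation of `FIX^x_b` -/

section Fix

variable {I G : Graph T Tag}

theorem isFibration_fix (b : I.Bang) (x : Tag) :
    IsFibration (I' := I.fix b x) (I := I) (fun y => y) where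
  bang _ h := h
  le _ _ _ _ h := h
  lift _ c _ hc h := ⟨c, hc, rfl, h⟩
  uniq _ _ _ _ _ _ _ _ h := h

theorem isSec_push_fix {b : I.Bang} {x : Tag} (F : BoxFam (I.fix b x)) {U : Set I.V}
    {κ : Set F.X} : F.IsSec U κ ↔ (F.push _ (isFibration_fix b x)).IsSec U κ :=
  ⟨fun h => ⟨h.mem, h.ex, h.inj, h.closed⟩, fun h => ⟨h.mem, h.ex, h.inj, h.closed⟩⟩

variable (i : Emb I G) (b : I.Bang) (c : G.Bang) (x : Tag) (i' : Emb (I.fix b x) (G.fix c x))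
  (h : ∀ y, i'.fV y = i.fV y)

include h

theorem encl_fix (y : G.V) : encl i' y = encl i y :=
  Set.ext fun a => and_congr_right fun _ => iff_of_eq (congrArg (fun v => y ∈ G.box v) (h a))

theorem enclE_fix (a : G.E) : enclE i' a = enclE i a :=
  congrArg₂ (· ∪ ·) (encl_fix i b c x i' h (G.src a)) (encl_fix i b c x i' h (G.tgt a))

/-- Instantiation does not depend on which `!`-vertices are fixed. -/
def instMapFix (F : BoxFam (I.fix b x)) : InstMap i' i F _ (isFibration_fix b x) where
  P y := y
  PE a := a
  src _ := rfl
  tgt _ := rfl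
  vty _ := rfl
  ety _ := rfl
  secV y κ hκ := by
    rw [encl_fix i b c x i' h y] at hκ; exact (isSec_push_fix F).1 hκ
  secE y κ hκ := by
    rw [enclE_fix i b c x i' h y] at hκ; exact (isSec_push_fix F).1 hκ
  restr_src a _ _ z _ := Set.ext_iff.1 (encl_fix i b c x i' h (G.src a)) (F.proj z)
  restr_tgt a _ _ z _ := Set.ext_iff.1 (encl_fix i b c x i' h (G.tgt a)) (F.proj z)
  injV _ _ _ _ _ h := h
  injE _ _ _ _ _ h := h
  surjV y κ hκ := ⟨y, rfl, by rw [encl_fix i b c x i' h y]; exact (isSec_push_fix F).2 hκ⟩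
  surjE y κ hκ := ⟨y, rfl, by rw [enclE_fix i b c x i' h y]; exact (isSec_push_fix F).2 hκ⟩

end Fix

/-- The family `F`, regarded as a family over the same graph with `b` made fixed. -/
def BoxFam.fix {I : Graph T Tag} (F : BoxFam I) (b : I.Bang) (x : Tag) : BoxFam (I.fix b x) :=
  ⟨F.X, F.fin, F.proj, F.rel, F.bang, F.rel_refl, F.rel_trans, F.le, F.lift, F.uniq⟩

namespace Span

variable {e f g : Span T Tag}

theorem inst_fix_iso (b : e.I.Bang) (x : Tag) (F : BoxFam (e.fix b x).I) :
    ((e.fix b x).inst F).Iso (e.inst (F.push _ (isFibration_fix b x))) :=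
  inst_iso_of_instMap (instMapFix e.left b _ x (e.fix b x).left (fun _ => rfl) F)
    (instMapFix (Emb.id e.I) b b x (Emb.id _) (fun _ => rfl) F)
    (instMapFix e.right b _ x (e.fix b x).right (fun _ => rfl) F)
    (fun _ => rfl) (fun _ => rfl) (fun _ => rfl) (fun _ => rfl)

/-- In the expansions of `FIX^x_b(e)` the top-level `!`-vertex `b` is instantiated as often as the
value at `x` says, and the other fixed `!`-vertices are treated as in `e`. -/
theorem isExpansion_fix_iff [DecidableEq Tag] {b : e.I.Bang} {x : Tag} (hx : x ∉ e.tags)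
    {lam : Tag → ℕ} {n : ℕ} : (e.fix b x).IsExpansion (Function.update lam x n) g ↔
      ∃ F : BoxFam e.I, RespectsOff lam F {b.1} ∧ (F.fib b.1).ncard = n ∧ (e.inst F).Iso g := by
  have hne : ∀ c y, e.I.tag c = some y → y ≠ x := by
    rintro c y hy rfl
    exact hx ⟨c, hy⟩
  constructor
  · rintro ⟨F, hF, hiso⟩
    refine ⟨F.push _ (isFibration_fix b x), fun c y hc hy => ?_, ?_,
      (inst_fix_iso b x F).symm.trans hiso⟩
    · refine (hF c y (fun h => h) ((tag_fix_of_ne hc).trans hy)).trans ?_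
      exact Function.update_of_ne (hne c y hy) _ _
    · exact (hF b.1 x (fun h => h) (tag_fix_self b x)).trans (Function.update_self _ _ _)
  · rintro ⟨F, hF, hn, hiso⟩
    refine ⟨F.fix b x, fun c y _ hy => ?_, (inst_fix_iso b x (F.fix b x)).trans hiso⟩
    by_cases h : c = b.1
    · subst h
      rw [tag_fix_self] at hy
      cases hy
      exact hn.trans (Function.update_self x n lam).symm
    · rw [tag_fix_of_ne (e := e) h] at hy
      exact (hF c y h hy).trans (Function.update_of_ne (hne c y hy) _ _).symm

end Span

/-! ### Soundness of induction -/

open BangGraph.Span in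
theorem mem_concreteInstances {E : Set (Span T Tag)} (hE : ∀ e ∈ E, e.Good ∧ e.FixedTop)
    {A : Set Tag} {lam : Tag → ℕ} {g : Span T Tag} :
    g ∈ concreteInstances (expandedAxioms E A lam) ↔
      ∃ e ∈ E, e.tags ⊆ A ∧ e.IsExpansion lam g := by
  constructor
  · rintro ⟨f, ⟨e, he, hA, hf⟩, hfg, hg⟩
    exact ⟨e, he, hA, hf.exists_inst (hE e he).1 (hE e he).2 hfg hg⟩
  · rintro ⟨e, he, hA, hg⟩
    obtain ⟨f, hf, hfg⟩ := hg.exists_fixedExpansion (hE e he).1 (hE e he).2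
    exact ⟨f, ⟨e, he, hA, hf⟩, hfg, hg.concrete⟩

theorem Entails.derivable {E : Set (Span T Tag)} {e g : Span T Tag} (h : Entails E e)
    (he : e.Good) (ht : e.FixedTop) {lam : Tag → ℕ} (hg : e.IsExpansion lam g) :
    StringDerivable (concreteInstances (expandedAxioms E e.tags lam)) g := by
  obtain ⟨f, hf, hfg⟩ := hg.exists_fixedExpansion he ht
  exact h lam f g hf hfg hg.concrete

end BangGraph

open BangGraph BangGraph.Span in
theorem mainTheorem1 {T : BangGraph.Signature.{u, v}} {Tag : Type w}
    (E : Set (BangGraph.Span T Tag)) (hE : ∀ e ∈ E, e.IsEquation)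
    (e : BangGraph.Span T Tag) (he : e.IsEquation)
    (b : e.I.Bang) (hb : e.I.TopLevel b.1) (hfix : e.I.tag b.1 = none)
    (x : Tag) (hx : x ∉ e.tags) (hxE : ∀ e' ∈ E, x ∉ e'.tags)
    (base : BangGraph.Entails E (e.kill b))
    (step : BangGraph.Entails (E ∪ {e.fix b x}) ((e.exp b).fix (e.keep b) x)) :
    BangGraph.Entails E e := by
  classical
  have hG := he.good
  have ht := he.fixedTop
  have hb' := hb.isTop
  have hE' : ∀ e' ∈ E, e'.Good ∧ e'.FixedTop := fun e' h => ⟨(hE e' h).good, (hE e' h).fixedTop⟩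
  intro lam f g hf hfg hg
  -- the claim that is proved by induction on the number of instantiations of `b`
  have key : ∀ (n : ℕ) (g : Span T Tag),
      (e.fix b x).IsExpansion (Function.update lam x n) g →
      StringDerivable (concreteInstances (expandedAxioms E e.tags lam)) g := by
    intro n
    induction n with
    | zero =>
      intro g hg
      obtain ⟨F, hF, hn, hiso⟩ := (isExpansion_fix_iff hx).1 hg
      have := F.fin
      obtain ⟨F', hF'⟩ := hG.exists_killRel_pull b F ((Set.ncard_eq_zero (Set.toFinite _)).1 hn)
      refine (base.derivable (hG.kill b) (ht.kill b) (lam := lam)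
        ⟨F', (hF'.respectsOff_iff ht lam).1 hF, hF'.iso.trans hiso⟩).cut fun a ha => .ax ?_
      obtain ⟨e', he', hA, ha⟩ := (mem_concreteInstances hE').1 ha
      exact (mem_concreteInstances hE').2 ⟨e', he', hA.trans (tags_kill_subset b), ha⟩
    | succ n ih =>
      intro g hg
      obtain ⟨F, hF, hn, hiso⟩ := (isExpansion_fix_iff hx).1 hg
      obtain ⟨F', hF'⟩ := hG.exists_expRel_pull b hb' F
        (Set.nonempty_of_ncard_ne_zero (by rw [hn]; exact n.succ_ne_zero))
      have hn' : (F'.fib (e.keep b).1).ncard = n := by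
        have := hF'.fib
        omega
      have hexp : ((e.exp b).fix (e.keep b) x).IsExpansion (Function.update lam x n) g :=
        (isExpansion_fix_iff (fun h => hx (tags_exp_subset b h))).2
          ⟨F', (hF'.respectsOff_iff ht lam).1 hF, hn', hF'.iso.trans hiso⟩
      have hEx : ∀ e' ∈ E ∪ {e.fix b x}, e'.Good ∧ e'.FixedTop := by
        rintro e' (h | rfl)
        · exact hE' e' h
        · exact ⟨hG.fix b x, ht.fix hb' x⟩
      refine (step.derivable ((hG.exp b).fix _ x) ((ht.exp hG b).fix (isTop_keep hG hb') x)
        hexp).cut fun a ha => ?_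
      obtain ⟨e', he', hA, ha⟩ := (mem_concreteInstances hEx).1 ha
      rcases he' with he' | rfl
      · have hA' : e'.tags ⊆ e.tags := fun y hy => by
          rcases tags_fix_subset _ _ (hA hy) with rfl | h
          · exact (hxE e' he' hy).elim
          · exact tags_exp_subset b h
        refine .ax ((mem_concreteInstances hE').2 ⟨e', he', hA', ha.congr fun y hy => ?_⟩)
        exact Function.update_of_ne (fun h : y = x => hxE e' he' (h ▸ hy)) _ _
      -- `b` is instantiated only `n` times in the axioms coming from `FIX^x_b(e)`
      · exact ih a ha
  obtain ⟨F, hF, hiso⟩ := hf.exists_inst hG ht hfg hg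
  exact key _ g ((isExpansion_fix_iff hx).2
    ⟨F, fun c y _ hy => hF c y (fun h => h) hy, rfl, hiso⟩)
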